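/- **Conventions.** A path is a continuous map of a segment $[a,b]$ into a metric space; a domain is a nonempty open connected set; a continuum is a nonempty compact connected set. For a metric space $X$ with a Borel measure $\mu$, a family $\Gamma$ of paths in $X$ and $p\ge 1$, put $M_p(\Gamma)=\inf_\rho\int_X\rho^p\,d\mu$, the infimum over all Borel $\rho:X\to[0,\infty]$ with $\int_\gamma\rho\,ds\ge 1$ for every rectifiable $\gamma\in\Gamma$ ($\inf\varnothing=\infty$). A metric measure space $(Y,d,\nu)$ * is *Ahlfors $\alpha$-regular* if for some $C\ge1$ one has $C^{-1}R^\alpha\le\nu(B(y,R))\le CR^\alpha$ for all $y\in Y$ and $0<R\le\operatorname{diam}Y$; * is *upper $\alpha$-regular* if for every $y\in Y$ there are $C,r_0>0$ with $\nu(B(y,r))\le Cr^\alpha$ for $0<r<r_0$; * *supports a $(1;p)$-Poincaré inequality* if there are $C\ge1$, $\tau>0$ such that, for every ball $B=B(y,R)$, $\tau B=B(y,\tau R)$, every continuous $u:Y\to\mathbb R$ integrable on $B$, with mean value $u_B$ over $B$, and every Borel $\rho:Y\to[0,\infty]$ with $|u(x)-u(z)|\le\int_\gamma\rho\,ds$ for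 every rectifiable path $\gamma$ joining any points $x,z$, $$\frac1{\nu(B)}\int_B|u-u_B|\,d\nu\le C\,(\operatorname{diam}B)\Big(\frac1{\nu(\tau B)}\int_{\tau B}\rho^p\,d\nu\Big)^{1/p}.$$ A measurable $Q:Y\to[0,\infty]$ belongs to $FMO(y_0)$ if it is integrable on some ball centred at $y_0$ and $\limsup_{\varepsilon\to0}\frac1{\nu(B(y_0,\varepsilon))}\int_{B(y_0,\varepsilon)}|Q-\overline Q_\varepsilon|\,d\nu<\infty$, where $\overline Q_\varepsilon$ is the mean value of $Q$ over $B(y_0,\varepsilon)$ (mean values over balls of measure zero are read as $0$); $Q\in FMO(K)$ means $Q\in FMO(y_0)$ for all $y_0\in K$. **The class of mappings.** Let $(X,d,\mu)$, $(X',d',\mu')$ be metric spaces with Borel measures, $0<\mu(B)<\infty$ for all balls $B\subset X$, $\mu'$ locally finite. Let $D\subset X$ and $D'\subset X'$ be domains, $E\subset D$ a continuum, $\delta>0$, $p\ge1$, $q>0$, and $Q:X'\to[0,\infty]$ measurable. Write $S(y_0,r)=\{y\in X':d'(y,y_0)=r\}$ and $A(y_0,r_1,r_2)=\{y\in X':r_1<d'(y,y_0)<r_2\}$.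 For $f:D\to D'$ let $\Gamma_f(y_0,r_1,r_2)$ be the family of all paths $\gamma:[a,b]\to D$ with $f(\gamma(a))\in S(y_0,r_1)$, $f(\gamma(b))\in S(y_0,r_2)$ and $f(\gamma(t))\in A(y_0,r_1,r_2)$ for $t\in(a,b)$. Denote by $\mathfrak F^{p,q,Q}_{E,\delta}(D,D')$ the family of all continuous, open, discrete $f:D\to D'$ such that $\operatorname{diam}f(E)\ge\delta$ and, for every $y_0\in X'$, all $0<r_1<r_2<\sup_{y\in f(D)}d'(y,y_0)$ and all Lebesgue measurable $\eta:(r_1,r_2)\to[0,\infty]$ with $\int_{r_1}^{r_2}\eta(r)\,dr\ge1$, $$M_p(\Gamma_f(y_0,r_1,r_2))\le\int_{f(D)\cap A(y_0,r_1,r_2)}Q(y)\,\eta^{q}(d'(y,y_0))\,d\mu'(y).$$ **Theorem 1.2.** Let $\alpha,\alpha'\ge2$, $\alpha-1<p\le\alpha$ and $0<q\le\alpha'$. Let $D$, with the induced metric and measure, be locally connected, locally compact and Ahlfors $\alpha$-regular (hence of Hausdorff dimension $\alpha$), and let it support a $(1;p)$-Poincaré inequality. Let $\overline{D'}$ be compact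 in $X'$. Let $X'$ be locally path connected, locally compact and upper $\alpha'$-regular, and suppose that for every $z_0\in X'$ there are $\gamma,r_0>0$ with $$\mu'(B(z_0,2r))\le\gamma\,\log^{\alpha'-2}\tfrac1r\;\mu'(B(z_0,r))\qquad(0<r<r_0).$$ Let $Q\in FMO(\overline{D'})$, and suppose that the family $\mathfrak F^{p,q,Q}_{E,\delta}(D,D')$ is equicontinuous at every point of $E$. Let $x_0\in D$ and $\varepsilon_1>0$ with $B(x_0,\varepsilon_1)\subset D$. Then there is $r_0>0$, independent of $f$, such that $$f(B(x_0,\varepsilon_1))\supset B(f(x_0),r_0)=\{w\in X':d'(w,f(x_0))<r_0\}\qquad\text{for all } f\in\mathfrak F^{p,q,Q}_{E,\delta}(D,D').$$ -/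

import Mathlib

open Set Filter Topology MeasureTheory
open scoped ENNReal

namespace KoebeMetric

/-! ### Paths, line integrals, modulus -/

/-- A path `γ : [a, b] → X`; the values of `toFun` outside `[a, b]` play no role. -/
structure Curve (X : Type*) [TopologicalSpace X] where
  a : ℝ
  b : ℝ
  le : a ≤ b
  toFun : ℝ → X
  continuousOn : ContinuousOn toFun (Icc a b)

/-- The length of a path: the supremum of `∑ d(γ(tᵢ), γ(tᵢ₋₁))` over all partitions of `[a, b]`. -/
noncomputable def Curve.length {X : Type*} [MetricSpace X] (γ : Curve X) : ℝ≥0∞ :=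
  eVariationOn γ.toFun (Icc γ.a γ.b)

/-- A path is rectifiable if its length is finite. -/
def Curve.Rectifiable {X : Type*} [MetricSpace X] (γ : Curve X) : Prop :=
  γ.length ≠ ∞

/-- The line integral `∫_γ ρ ds = ∫_0^{ℓ(γ)} ρ(γ₀(s)) ds` of a nonnegative function along a
rectifiable path, where `γ₀` is the arc-length parametrization of `γ`. -/
noncomputable def Curve.lineIntegral {X : Type*} [MetricSpace X] (γ : Curve X)
    (ρ : X → ℝ≥0∞) : ℝ≥0∞ :=
  ∫⁻ s in Icc (0 : ℝ) γ.length.toReal,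
    ρ (naturalParameterization γ.toFun (Icc γ.a γ.b) γ.a s)

/-- `ρ` is admissible for the path family `Γ`: it is a Borel function `X → [0, ∞]` with
`∫_γ ρ ds ≥ 1` for every rectifiable `γ ∈ Γ`. -/
def Admissible {X : Type*} [MetricSpace X] [MeasurableSpace X] (Γ : Set (Curve X))
    (ρ : X → ℝ≥0∞) : Prop :=
  Measurable ρ ∧ ∀ γ ∈ Γ, γ.Rectifiable → 1 ≤ γ.lineIntegral ρ

/-- The `p`-modulus of a path family (it is `∞` if there is no admissible function). -/
noncomputable def modulus {X : Type*} [MetricSpace X] [MeasurableSpace X] (μ : Measure X)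
    (p : ℝ) (Γ : Set (Curve X)) : ℝ≥0∞ :=
  ⨅ (ρ : X → ℝ≥0∞) (_ : Admissible Γ ρ), ∫⁻ x, ρ x ^ p ∂μ

/-! ### Ahlfors regularity, upper regularity, Poincaré inequality, mean oscillation -/

/-- `(X, d, μ)` is Ahlfors `s`-regular: `R ^ s / C ≤ μ(B(x, R)) ≤ C R ^ s` with one constant
`C ≥ 1` for all `x` and all radii `0 < R ≤ diam X`. -/
def AhlforsRegular {X : Type*} [MetricSpace X] [MeasurableSpace X] (μ : Measure X)
    (s : ℝ) : Prop :=
  ∃ C : ℝ, 1 ≤ C ∧ ∀ (x : X) (R : ℝ), 0 < R → ENNReal.ofReal R ≤ Metric.ediam (univ : Set X) →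
    ENNReal.ofReal (R ^ s / C) ≤ μ (Metric.ball x R) ∧
      μ (Metric.ball x R) ≤ ENNReal.ofReal (C * R ^ s)

/-- `(X, d, μ)` is upper `s`-regular: for every `x` there are `C, r₀ > 0` such that
`μ(B(x, r)) ≤ C r ^ s` for `0 < r < r₀`. -/
def UpperRegular {X : Type*} [MetricSpace X] [MeasurableSpace X] (μ : Measure X)
    (s : ℝ) : Prop :=
  ∀ x : X, ∃ C : ℝ, 0 < C ∧ ∃ r₀ : ℝ, 0 < r₀ ∧ ∀ r : ℝ, 0 < r → r < r₀ →
    μ (Metric.ball x r) ≤ ENNReal.ofReal (C * r ^ s)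

/-- The Borel function `ρ : X → [0, ∞]` is an upper gradient of `u`: `|u(x) - u(y)| ≤ ∫_γ ρ ds`
for every rectifiable path `γ` joining `x` and `y`. -/
def IsUpperGradient {X : Type*} [MetricSpace X] [MeasurableSpace X] (ρ : X → ℝ≥0∞)
    (u : X → ℝ) : Prop :=
  Measurable ρ ∧ ∀ γ : Curve X, γ.Rectifiable →
    ENNReal.ofReal |u (γ.toFun γ.a) - u (γ.toFun γ.b)| ≤ γ.lineIntegral ρ

/-- `(X, d, μ)` supports the `(1; p)`-Poincaré inequality. Continuous functions are locally
bounded; integrability on the ball is what makes the mean value `u_B` meaningful. -/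
def SupportsPoincare {X : Type*} [MetricSpace X] [MeasurableSpace X] (μ : Measure X)
    (p : ℝ) : Prop :=
  ∃ C : ℝ, 1 ≤ C ∧ ∃ τ : ℝ, 0 < τ ∧
    ∀ u : X → ℝ, Continuous u → ∀ ρ : X → ℝ≥0∞, IsUpperGradient ρ u →
      ∀ (x : X) (R : ℝ), 0 < R → IntegrableOn u (Metric.ball x R) μ →
        ⨍⁻ y in Metric.ball x R,
            ENNReal.ofReal |u y - ⨍ z in Metric.ball x R, u z ∂μ| ∂μ ≤
          ENNReal.ofReal C * Metric.ediam (Metric.ball x R) *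
            (⨍⁻ y in Metric.ball x (τ * R), ρ y ^ p ∂μ) ^ (1 / p)

/-- `φ : X → [0, ∞]` has finite mean oscillation at `x₀`: it is integrable on some ball centred
at `x₀`, and the mean over `B(x₀, ε)` of `|φ - φ_ε|`, where `φ_ε` is the mean value of `φ` over
`B(x₀, ε)`, has a finite upper limit as `ε → 0+`. -/
def FMOAt {X : Type*} [MetricSpace X] [MeasurableSpace X] (μ : Measure X)
    (φ : X → ℝ≥0∞) (x₀ : X) : Prop :=
  (∃ r : ℝ, 0 < r ∧ ∫⁻ x in Metric.ball x₀ r, φ x ∂μ < ∞) ∧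
    limsup (fun ε : ℝ => ⨍⁻ x in Metric.ball x₀ ε,
      ENNReal.ofReal |(φ x).toReal - ⨍ z in Metric.ball x₀ ε, (φ z).toReal ∂μ| ∂μ) (𝓝[>] 0) < ∞

/-! ### The inverse Poletsky inequality and the class of mappings -/

/-- The open ring `A(y₀, r₁, r₂) = {y : r₁ < d(y, y₀) < r₂}`. -/
def annulus {Y : Type*} [MetricSpace Y] (y₀ : Y) (r₁ r₂ : ℝ) : Set Y :=
  {y | r₁ < dist y y₀ ∧ dist y y₀ < r₂}

/-- The family `Γ_f(y₀, r₁, r₂)` of all paths `γ : [a, b] → D` such that `f ∘ γ` starts on the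
sphere `S(y₀, r₁)`, ends on the sphere `S(y₀, r₂)` and lies in the ring `A(y₀, r₁, r₂)` at all
times `t ∈ (a, b)`. -/
def preimagePaths {X Y : Type*} [MetricSpace X] [MetricSpace Y] (D : Set X) (f : X → Y)
    (y₀ : Y) (r₁ r₂ : ℝ) : Set (Curve X) :=
  {γ | (∀ t ∈ Icc γ.a γ.b, γ.toFun t ∈ D) ∧
    f (γ.toFun γ.a) ∈ Metric.sphere y₀ r₁ ∧ f (γ.toFun γ.b) ∈ Metric.sphere y₀ r₂ ∧
    ∀ t ∈ Ioo γ.a γ.b, f (γ.toFun t) ∈ annulus y₀ r₁ r₂}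

/-- The inverse Poletsky inequality with respect to `(p, q)`-moduli at `y₀`:
`M_p(Γ_f(y₀, r₁, r₂)) ≤ ∫_{f(D) ∩ A(y₀, r₁, r₂)} Q(y) η(d(y, y₀)) ^ q dν(y)` for all
`0 < r₁ < r₂ < sup_{y ∈ f(D)} d(y, y₀)` and all Lebesgue measurable `η : (r₁, r₂) → [0, ∞]` with
`∫_{r₁}^{r₂} η(r) dr ≥ 1`. -/
def InversePoletsky {X Y : Type*} [MetricSpace X] [MeasurableSpace X] [MetricSpace Y]
    [MeasurableSpace Y] (μ : Measure X) (ν : Measure Y) (p q : ℝ) (Q : Y → ℝ≥0∞)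
    (D : Set X) (f : X → Y) (y₀ : Y) : Prop :=
  ∀ r₁ r₂ : ℝ, 0 < r₁ → r₁ < r₂ → (∃ x ∈ D, r₂ < dist (f x) y₀) →
    ∀ η : ℝ → ℝ≥0∞, AEMeasurable η (volume.restrict (Ioo r₁ r₂)) →
      1 ≤ ∫⁻ r in Ioo r₁ r₂, η r →
        modulus μ p (preimagePaths D f y₀ r₁ r₂) ≤
          ∫⁻ y in f '' D ∩ annulus y₀ r₁ r₂, Q y * η (dist y y₀) ^ q ∂ν

/-- `f` restricts to an open discrete (continuous) mapping of the open set `D` into `D'`. Only the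
values of `f` on `D` matter. -/
structure IsOpenDiscreteMap {X Y : Type*} [MetricSpace X] [MetricSpace Y] (D : Set X)
    (D' : Set Y) (f : X → Y) : Prop where
  mapsTo : MapsTo f D D'
  continuousOn : ContinuousOn f D
  isOpen_image : ∀ U ⊆ D, IsOpen U → IsOpen (f '' U)
  /-- every point of a fibre `f⁻¹(y) ⊆ D` is isolated in that fibre -/
  discrete : ∀ x ∈ D, ∀ᶠ z in 𝓝[D \ {x}] x, f z ≠ f x

/-- The class `𝔉^{p,q,Q}_{E,δ}(D, D')` of all open discrete mappings `f : D → D'` that satisfy the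
inverse Poletsky inequality with respect to `(p, q)`-moduli at every point `y₀` of the target
space, and for which the diameter of `f(E)` is at least `δ`. -/
def mappingClass {X Y : Type*} [MetricSpace X] [MeasurableSpace X] [MetricSpace Y]
    [MeasurableSpace Y] (μ : Measure X) (ν : Measure Y) (p q : ℝ) (Q : Y → ℝ≥0∞)
    (E : Set X) (δ : ℝ) (D : Set X) (D' : Set Y) : Set (X → Y) :=
  {f | IsOpenDiscreteMap D D' f ∧ (∀ y₀ : Y, InversePoletsky μ ν p q Q D f y₀) ∧
    δ ≤ Metric.diam (f '' E)}

end KoebeMetric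

namespace KoebeMetric

/-! ### The arc-length parametrization -/

/-! Two estimates for the modulus of one path family contradict each other. Fix `y` in the closure
of `D'`, a small ring around `y`, and a connected neighbourhood `V` of `y` inside the inner ball. If
`f x₀ ∈ V` but the image of the ball misses a point of `V`, the component of the preimage of `V` at
`x₀` must reach a sphere around `x₀` (`exists_mem_compactsCrossing`); its closure is a continuum of
definite size lying over the inner ball. Equicontinuity on `E` and `diam f(E) ≥ δ` give finitely
many balls, chosen independently of `f`, one of which lies over the outside of the ring
(`exists_finite_far_balls`). Paths from the continuum to that ball cross the ring.

The modulus of these paths has a positive lower bound independent of `f`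
(`exists_path_to_closedBall`, `le_modulus_preimagePaths`), while finite mean oscillation of `Q` and
the inverse Poletsky inequality make it arbitrarily small for a suitable ring
(`exists_ring_energy_le`). Hence `V` is covered, and a Lebesgue number of the cover of the compact
closure of `D'` by the sets `V` is the required radius.

The lower bound rests on the Poincaré inequality, which is available for continuous functions only,
so the infimum of `∫ ρ` over paths cannot be used as a test function directly. It is replaced by the
least cost of discrete chains: these potentials are continuous, have the lower semicontinuous `ρ` as
upper gradient (`isUpperGradient_potential`), and where they stay below `1` at all scales the chains
converge to a true path (`exists_path_of_potential_lt_one`). By `exists_reached_of_energy`,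
estimates for continuous functions thus become statements about points reached by paths. Since `p >
α - 1`, a function of small energy vanishing on a crossing set is small on much of some ball
(`exists_average_le`, by telescoping means and a Vitali covering). Connectedness of `D` carries
reachability to any other ball (`uniformlyReached`), and scaling `ρ` makes the path integral less
than `1`. -/

theorem continuousOn_variationOnFromTo {X : Type*} [PseudoEMetricSpace X] {f : ℝ → X} {a b : ℝ}
    (hab : a ≤ b) (hf : ContinuousOn f (Icc a b)) (hbv : BoundedVariationOn f (Icc a b)) :
    ContinuousOn (variationOnFromTo f (Icc a b) a) (Icc a b) := by
  intro x hx
  have hl := hbv.locallyBoundedVariationOn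
  have h1 := hbv.tendsto_eVariationOn_Icc_zero_left (x := x)
    ((hf x hx).mono inter_subset_left)
  have h2 := hbv.tendsto_eVariationOn_Icc_zero_right x
    ((hf x hx).mono inter_subset_left)
  have h3 := ((ENNReal.tendsto_toReal ENNReal.zero_ne_top).comp h1).add
    ((ENNReal.tendsto_toReal ENNReal.zero_ne_top).comp h2)
  simp only [ENNReal.toReal_zero, add_zero] at h3
  rw [ContinuousWithinAt, tendsto_iff_dist_tendsto_zero]
  refine squeeze_zero' (Eventually.of_forall fun _ => dist_nonneg) ?_ h3
  filter_upwards [self_mem_nhdsWithin] with y hy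
  rw [Real.dist_eq]
  have hadd := variationOnFromTo.add hl (left_mem_Icc.2 hab) hx hy
  have : variationOnFromTo f (Icc a b) a y - variationOnFromTo f (Icc a b) a x
      = variationOnFromTo f (Icc a b) x y := by linarith
  rw [this]
  simp only [Function.comp]
  rcases le_total x y with h | h
  · rw [variationOnFromTo.eq_of_le f _ h, abs_of_nonneg ENNReal.toReal_nonneg]
    exact le_add_of_nonneg_left ENNReal.toReal_nonneg
  · rw [variationOnFromTo.eq_of_ge f _ h, abs_neg, abs_of_nonneg ENNReal.toReal_nonneg]
    exact le_add_of_nonneg_right ENNReal.toReal_nonneg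

/-- The arc-length function is continuous and monotone, so the intermediate value theorem leaves no
gaps; the unit-speed property therefore holds on the whole parameter segment. -/
theorem variationOnFromTo_image {X : Type*} [PseudoEMetricSpace X] {f : ℝ → X} {a b : ℝ}
    (hab : a ≤ b) (hf : ContinuousOn f (Icc a b)) (hbv : BoundedVariationOn f (Icc a b)) :
    variationOnFromTo f (Icc a b) a '' Icc a b = Icc 0 (eVariationOn f (Icc a b)).toReal := by
  have hv0 : variationOnFromTo f (Icc a b) a a = 0 := variationOnFromTo.self _ _ _
  have hvb : variationOnFromTo f (Icc a b) a b = (eVariationOn f (Icc a b)).toReal := by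
    rw [variationOnFromTo.eq_of_le f _ hab, inter_self]
  have hmono := variationOnFromTo.monotoneOn hbv.locallyBoundedVariationOn (left_mem_Icc.2 hab)
  apply Subset.antisymm
  · rintro _ ⟨t, ht, rfl⟩
    rw [← hvb, ← hv0]
    exact ⟨hmono (left_mem_Icc.2 hab) ht ht.1, hmono ht (right_mem_Icc.2 hab) ht.2⟩
  · rw [← hvb, ← hv0]
    exact intermediate_value_Icc hab (continuousOn_variationOnFromTo hab hf hbv)

theorem lipschitzOnWith_naturalParameterization {X : Type*} [MetricSpace X] {f : ℝ → X} {a b : ℝ}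
    (hab : a ≤ b) (hf : ContinuousOn f (Icc a b)) (hbv : BoundedVariationOn f (Icc a b)) :
    LipschitzOnWith 1 (naturalParameterization f (Icc a b) a)
      (Icc 0 (eVariationOn f (Icc a b)).toReal) := by
  have h := has_unit_speed_naturalParameterization f hbv.locallyBoundedVariationOn
    (left_mem_Icc.2 hab)
  rw [variationOnFromTo_image hab hf hbv] at h
  have key : ∀ x ∈ Icc 0 (eVariationOn f (Icc a b)).toReal,
      ∀ y ∈ Icc 0 (eVariationOn f (Icc a b)).toReal, x ≤ y →
      edist (naturalParameterization f (Icc a b) a x) (naturalParameterization f (Icc a b) a y)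
        ≤ edist x y := by
    intro x hx y hy hxy
    refine (eVariationOn.edist_le _ (s := Icc 0 (eVariationOn f (Icc a b)).toReal ∩ Icc x y)
      ⟨hx, le_rfl, hxy⟩ ⟨hy, hxy, le_rfl⟩).trans ?_
    rw [h hx hy, edist_comm, edist_dist, Real.dist_eq, abs_of_nonneg (by linarith)]
    simp
  intro x hx y hy
  rw [ENNReal.coe_one, one_mul]
  rcases le_total x y with hxy | hxy
  · exact key x hx y hy hxy
  · rw [edist_comm, edist_comm x]
    exact key y hy x hx hxy

theorem naturalParameterization_variationOnFromTo {X : Type*} [MetricSpace X] {f : ℝ → X}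
    {a b t : ℝ} (ht : t ∈ Icc a b) (hbv : BoundedVariationOn f (Icc a b)) :
    naturalParameterization f (Icc a b) a (variationOnFromTo f (Icc a b) a t) = f t :=
  edist_eq_zero.1 (edist_naturalParameterization_eq_zero hbv.locallyBoundedVariationOn
    (left_mem_Icc.2 (ht.1.trans ht.2)) ht)

/-- The path given by a `1`-Lipschitz map of a segment. -/
def Curve.ofLipschitz {X : Type*} [MetricSpace X] {φ : ℝ → X} {a b : ℝ} (hab : a ≤ b)
    (hφ : LipschitzOnWith 1 φ (Icc a b)) : Curve X :=
  ⟨a, b, hab, φ, hφ.continuousOn⟩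

theorem eVariationOn_le_of_lipschitzOnWith {X : Type*} [MetricSpace X] {φ : ℝ → X} {a b x y : ℝ}
    (hx : a ≤ x) (hy : y ≤ b) (hφ : LipschitzOnWith 1 φ (Icc a b)) :
    eVariationOn φ (Icc x y) ≤ ENNReal.ofReal (y - x) := by
  have h := hφ.comp_eVariationOn_le (f := φ) (g := (id : ℝ → ℝ)) (s := Icc x y)
    (fun t ht => ⟨hx.trans ht.1, ht.2.trans hy⟩)
  rw [ENNReal.coe_one, one_mul] at h
  refine h.trans ?_
  simp

theorem Curve.ofLipschitz_rectifiable {X : Type*} [MetricSpace X] {φ : ℝ → X} {a b : ℝ}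
    (hab : a ≤ b) (hφ : LipschitzOnWith 1 φ (Icc a b)) :
    (Curve.ofLipschitz hab hφ).Rectifiable :=
  ne_top_of_le_ne_top ENNReal.ofReal_ne_top
    (eVariationOn_le_of_lipschitzOnWith le_rfl le_rfl hφ)

/-- The arc-length function `v` of a `1`-Lipschitz path is itself `1`-Lipschitz, so it does not
increase length measure: the push-forward of Lebesgue measure under `v` dominates Lebesgue measure
on `[0, L]`. The inequality suffices because admissibility is only tested from below. -/
theorem Curve.lineIntegral_ofLipschitz_le {X : Type*} [MetricSpace X] [MeasurableSpace X]
    [BorelSpace X] {φ : ℝ → X} {a b : ℝ} (hab : a ≤ b) (hφ : LipschitzOnWith 1 φ (Icc a b))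
    {ρ : X → ℝ≥0∞} (hρ : Measurable ρ) :
    (Curve.ofLipschitz hab hφ).lineIntegral ρ ≤ ∫⁻ t in Icc a b, ρ (φ t) := by
  set s := Icc a b with hs
  have hbv : BoundedVariationOn φ s := Curve.ofLipschitz_rectifiable hab hφ
  set v := variationOnFromTo φ s a with hv
  set L := (eVariationOn φ s).toReal with hL
  have hL0 : 0 ≤ L := ENNReal.toReal_nonneg
  set γ := naturalParameterization φ s a with hγ
  have himg : v '' s = Icc 0 L := variationOnFromTo_image hab hφ.continuousOn hbv
  have hmono : MonotoneOn v s :=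
    variationOnFromTo.monotoneOn hbv.locallyBoundedVariationOn (left_mem_Icc.2 hab)
  have hvlip : LipschitzOnWith 1 v s := by
    apply LipschitzOnWith.of_dist_le_mul
    have key : ∀ x ∈ s, ∀ y ∈ s, x ≤ y → dist (v x) (v y) ≤ dist x y := by
      intro x hx y hy hxy
      have hadd := variationOnFromTo.add hbv.locallyBoundedVariationOn (left_mem_Icc.2 hab) hx hy
      rw [variationOnFromTo.eq_of_le φ s hxy] at hadd
      have h1 : s ∩ Icc x y = Icc x y :=
        inter_eq_right.2 (fun t ht => ⟨hx.1.trans ht.1, ht.2.trans hy.2⟩)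
      rw [h1] at hadd
      have h2 := ENNReal.toReal_mono ENNReal.ofReal_ne_top
        (eVariationOn_le_of_lipschitzOnWith hx.1 hy.2 hφ)
      rw [ENNReal.toReal_ofReal (by linarith)] at h2
      rw [dist_comm, dist_comm x, Real.dist_eq, Real.dist_eq, abs_of_nonneg (sub_nonneg.2 hxy),
        abs_of_nonneg (sub_nonneg.2 (hmono hx hy hxy))]
      linarith
    intro x hx y hy
    rw [NNReal.coe_one, one_mul]
    rcases le_total x y with h | h
    · exact key x hx y hy h
    · rw [dist_comm, dist_comm x]; exact key y hy x hx h
  have hvm : AEMeasurable v (volume.restrict s) :=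
    aemeasurable_restrict_of_monotoneOn measurableSet_Icc hmono
  have hle : volume.restrict (Icc 0 L) ≤ (volume.restrict s).map v := by
    rw [Measure.le_iff]
    intro A hA
    rw [Measure.map_apply_of_aemeasurable hvm hA, Measure.restrict_apply hA,
      Measure.restrict_apply' measurableSet_Icc]
    have hsub : A ∩ Icc 0 L ⊆ v '' (v ⁻¹' A ∩ s) := by
      rintro y ⟨hyA, hyL⟩
      rw [← himg] at hyL
      obtain ⟨t, ht, rfl⟩ := hyL
      exact ⟨t, ⟨hyA, ht⟩, rfl⟩
    refine (measure_mono hsub).trans ?_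
    have := (hvlip.mono (inter_subset_right : v ⁻¹' A ∩ s ⊆ s)).hausdorffMeasure_image_le
      (d := 1) zero_le_one
    simpa [hausdorffMeasure_real] using this
  have hγc : ContinuousOn γ (Icc 0 L) :=
    (lipschitzOnWith_naturalParameterization hab hφ.continuousOn hbv).continuousOn
  -- Only the restriction of `γ` to `[0, L]` is known to be continuous; extending it by constants
  -- gives a Borel integrand on all of `ℝ`.
  have hFm : Measurable (fun t => ρ (IccExtend hL0 (fun t : Icc 0 L => γ t) t)) := by
    apply hρ.comp
    exact (Continuous.Icc_extend' (by exact continuousOn_iff_continuous_domRestrict.1 hγc)).measurable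
  calc (Curve.ofLipschitz hab hφ).lineIntegral ρ = ∫⁻ t in Icc 0 L, ρ (γ t) := rfl
    _ = ∫⁻ t in Icc 0 L, ρ (IccExtend hL0 (fun t : Icc 0 L => γ t) t) := by
      refine setLIntegral_congr_fun measurableSet_Icc (fun t ht => ?_)
      simp only [IccExtend_of_mem hL0 _ ht]
    _ ≤ ∫⁻ t, ρ (IccExtend hL0 (fun t : Icc 0 L => γ t) t) ∂((volume.restrict s).map v) :=
      lintegral_mono' hle le_rfl
    _ = ∫⁻ t in s, ρ (IccExtend hL0 (fun t : Icc 0 L => γ t) (v t)) :=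
      lintegral_map' hFm.aemeasurable hvm
    _ = ∫⁻ t in s, ρ (φ t) := by
      refine setLIntegral_congr_fun measurableSet_Icc (fun t ht => ?_)
      have hvt : v t ∈ Icc 0 L := himg ▸ mem_image_of_mem v ht
      simp only [IccExtend_of_mem hL0 _ hvt]
      rw [hγ, hv, naturalParameterization_variationOnFromTo ht hbv]

/-! ### Discrete potentials -/

section Potential

variable {Y : Type*} [MetricSpace Y]

/-- The price per unit length of a step of a chain at scale `1 / (n + 1)` starting at `x`. -/
noncomputable def stepCost (ρ : Y → ℝ≥0∞) (n : ℕ) (x : Y) : ℝ≥0∞ :=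
  min (n : ℝ≥0∞) (⨅ y ∈ Metric.ball x (2 / ((n : ℝ) + 1)), ρ y)

/-- `ChainTo ρ G n x s`: the point `x` is reached from `G` by a chain with steps shorter than
`1 / (n + 1)` and total cost `s`. -/
inductive ChainTo (ρ : Y → ℝ≥0∞) (G : Set Y) (n : ℕ) : Y → ℝ≥0∞ → Prop
  | base {x : Y} (hx : x ∈ G) : ChainTo ρ G n x 0
  | step {x y : Y} {s : ℝ≥0∞} (h : ChainTo ρ G n x s) (hd : dist x y < 1 / ((n : ℝ) + 1)) :
      ChainTo ρ G n y (s + stepCost ρ n x * edist x y)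

/-- The least cost of a chain from `G` to `x`, truncated at `1`. -/
noncomputable def potential (ρ : Y → ℝ≥0∞) (G : Set Y) (n : ℕ) (x : Y) : ℝ≥0∞ :=
  min 1 (⨅ (s : ℝ≥0∞) (_ : ChainTo ρ G n x s), s)

variable {ρ : Y → ℝ≥0∞} {G : Set Y} {n : ℕ}

theorem stepCost_le_nat (x : Y) : stepCost ρ n x ≤ n := min_le_left _ _

theorem stepCost_le {x y : Y} (h : dist x y < 2 / ((n : ℝ) + 1)) : stepCost ρ n x ≤ ρ y :=
  (min_le_right _ _).trans (iInf₂_le y (Metric.mem_ball'.2 h))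

theorem stepCost_le_stepCost {m : ℕ} (hmn : m ≤ n) {x y : Y}
    (h : dist x y + 2 / ((n : ℝ) + 1) ≤ 2 / ((m : ℝ) + 1)) :
    stepCost ρ m x ≤ stepCost ρ n y := by
  refine le_min ((min_le_left _ _).trans (by exact_mod_cast hmn)) ?_
  refine le_iInf₂ fun w hw => stepCost_le ?_
  have := dist_triangle x y w
  rw [Metric.mem_ball'] at hw
  linarith

theorem stepCost_mono {m : ℕ} (hmn : m ≤ n) (x : Y) : stepCost ρ m x ≤ stepCost ρ n x := by
  apply stepCost_le_stepCost hmn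
  rw [dist_self, zero_add]
  gcongr

/-- Infima over shrinking balls recover the value exactly by lower semicontinuity. This is what lets
monotone convergence pass from chains back to `ρ`. -/
theorem iSup_stepCost (hρ : LowerSemicontinuous ρ) (x : Y) : ⨆ n, stepCost ρ n x = ρ x := by
  apply le_antisymm
  · exact iSup_le fun n => stepCost_le (by rw [dist_self]; positivity)
  · refine le_of_forall_lt fun a ha => ?_
    obtain ⟨b, hab, hb⟩ := exists_between ha
    obtain ⟨r, hr, hball⟩ := Metric.eventually_nhds_iff.1 (hρ x b hb)
    obtain ⟨k, hk⟩ := ENNReal.exists_nat_gt (ne_top_of_lt hb)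
    obtain ⟨l, hl⟩ := exists_nat_gt (2 / r)
    have hbk : b ≤ stepCost ρ (max k l) x := by
      refine le_min (hk.le.trans (by exact_mod_cast le_max_left k l)) (le_iInf₂ fun y hy => ?_)
      refine (hball ?_).le
      refine (Metric.mem_ball.1 hy).trans ?_
      rw [div_lt_iff₀ (by positivity)]
      rw [div_lt_iff₀ hr] at hl
      have : (l : ℝ) ≤ ((max k l : ℕ) : ℝ) := by exact_mod_cast le_max_right k l
      nlinarith
    exact hab.trans_le (hbk.trans (le_iSup (fun n => stepCost ρ n x) _))

/-- An infimum over open balls of fixed radius is upper semicontinuous for arbitrary `ρ`: its strict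
sublevel sets are unions of balls. -/
theorem measurable_stepCost [MeasurableSpace Y] [BorelSpace Y] : Measurable (stepCost ρ n) := by
  refine measurable_of_Iio fun a => ?_
  have : stepCost ρ n ⁻¹' Iio a =
      {_x | (n : ℝ≥0∞) < a} ∪ ⋃ y ∈ {y | ρ y < a}, Metric.ball y (2 / ((n : ℝ) + 1)) := by
    ext x
    simp only [stepCost, mem_preimage, mem_Iio, min_lt_iff, iInf_lt_iff, mem_union, mem_ofPred_eq,
      mem_iUnion, Metric.mem_ball, dist_comm x, exists_prop]
    tauto
  rw [this]
  refine (MeasurableSet.const _).union (IsOpen.measurableSet ?_)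
  exact isOpen_biUnion fun _ _ => Metric.isOpen_ball

theorem potential_le_one (x : Y) : potential ρ G n x ≤ 1 := min_le_left _ _

theorem potential_ne_top (x : Y) : potential ρ G n x ≠ ∞ :=
  ne_top_of_le_ne_top ENNReal.one_ne_top (potential_le_one x)

theorem potential_eq_zero {x : Y} (hx : x ∈ G) : potential ρ G n x = 0 :=
  le_antisymm ((min_le_right _ _).trans (iInf₂_le 0 (ChainTo.base hx))) bot_le

theorem potential_le_add {x y : Y} (h : dist x y < 1 / ((n : ℝ) + 1)) :
    potential ρ G n y ≤ potential ρ G n x + stepCost ρ n x * edist x y := by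
  rw [potential, potential, min_add]
  refine min_le_min le_self_add ?_
  simp only [ENNReal.iInf_add]
  exact le_iInf₂ fun s hs => iInf₂_le _ (ChainTo.step hs h)

/-- A fine chain is admissible at a coarser scale, and each of its steps is cheaper there. Hence the
potentials increase with `n`. -/
theorem ChainTo.exists_le_of_le {m : ℕ} (hmn : m ≤ n) {x : Y} {s : ℝ≥0∞}
    (h : ChainTo ρ G n x s) : ∃ s' ≤ s, ChainTo ρ G m x s' := by
  induction h with
  | base hx => exact ⟨0, le_rfl, ChainTo.base hx⟩
  | step h hd ih =>
    obtain ⟨s', hs', hc⟩ := ih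
    refine ⟨_, ?_, ChainTo.step hc (hd.trans_le (by gcongr))⟩
    gcongr
    exact stepCost_mono hmn _

theorem potential_mono {m : ℕ} (hmn : m ≤ n) (x : Y) : potential ρ G m x ≤ potential ρ G n x := by
  refine min_le_min le_rfl (le_iInf₂ fun s hs => ?_)
  obtain ⟨s', hs', hc⟩ := hs.exists_le_of_le hmn
  exact (iInf₂_le s' hc).trans hs'

/-- The truncation of the price at `n` is made for this local Lipschitz bound, the source of
continuity. -/
theorem abs_potential_sub_le {x y : Y} (h : dist x y < 1 / ((n : ℝ) + 1)) :
    |(potential ρ G n x).toReal - (potential ρ G n y).toReal| ≤ n * dist x y := by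
  have key : ∀ x y : Y, dist x y < 1 / ((n : ℝ) + 1) →
      (potential ρ G n y).toReal ≤ (potential ρ G n x).toReal + n * dist x y := by
    intro x y h
    have h1 : potential ρ G n y ≤ potential ρ G n x + n * edist x y :=
      (potential_le_add h).trans (by gcongr; exact stepCost_le_nat x)
    have h2 : (n : ℝ≥0∞) * edist x y ≠ ∞ :=
      ENNReal.mul_ne_top (ENNReal.natCast_ne_top n) (edist_ne_top x y)
    have h3 := ENNReal.toReal_mono (ENNReal.add_ne_top.2 ⟨potential_ne_top x, h2⟩) h1
    rwa [ENNReal.toReal_add (potential_ne_top x) h2, ENNReal.toReal_mul, ENNReal.toReal_natCast,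
      ← dist_edist] at h3
  rw [abs_le]
  have h1 := key x y h
  have h2 := key y x (by rwa [dist_comm])
  rw [dist_comm y x] at h2
  constructor <;> linarith

theorem continuous_potential : Continuous fun x => (potential ρ G n x).toReal := by
  rw [Metric.continuous_iff]
  intro x ε hε
  refine ⟨min (1 / ((n : ℝ) + 1)) (ε / ((n : ℝ) + 1)), by positivity, fun y hy => ?_⟩
  rw [Real.dist_eq]
  refine (abs_potential_sub_le (hy.trans_le (min_le_left _ _))).trans_lt ?_
  have := hy.trans_le (min_le_right _ _)
  rw [lt_div_iff₀ (by positivity)] at this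
  nlinarith [dist_nonneg (x := y) (y := x)]

/-- An arc shorter than the scale is a single chain step, and its price is at most the value of `ρ`
at every point of the arc. Longer arcs are cut into short ones. Both directions are needed for the
absolute value in the upper gradient inequality. -/
theorem potential_along_path {φ : ℝ → Y} {L : ℝ} (hφ : LipschitzOnWith 1 φ (Icc 0 L)) {s t : ℝ}
    (hs : 0 ≤ s) (hst : s ≤ t) (ht : t ≤ L) :
    potential ρ G n (φ t) ≤ potential ρ G n (φ s) + ∫⁻ r in Ioc s t, ρ (φ r) ∧
    potential ρ G n (φ s) ≤ potential ρ G n (φ t) + ∫⁻ r in Ioc s t, ρ (φ r) := by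
  set h : ℝ := 1 / ((n : ℝ) + 1) with hh
  have hpos : 0 < h := by positivity
  have hdist : ∀ {s t : ℝ}, 0 ≤ s → s ≤ t → t ≤ L → dist (φ s) (φ t) ≤ t - s := by
    intro s t hs hst ht
    have := hφ.dist_le_mul s ⟨hs, hst.trans ht⟩ t ⟨hs.trans hst, ht⟩
    rwa [NNReal.coe_one, one_mul, dist_comm s, Real.dist_eq, abs_of_nonneg (by linarith)] at this
  have hcost : ∀ {s t w : ℝ}, s ≤ t → dist (φ s) (φ t) ≤ t - s →
      (∀ r ∈ Ioc s t, dist (φ w) (φ r) < 2 / ((n : ℝ) + 1)) →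
      stepCost ρ n (φ w) * edist (φ s) (φ t) ≤ ∫⁻ r in Ioc s t, ρ (φ r) := by
    intro s t w hst hd hr
    calc stepCost ρ n (φ w) * edist (φ s) (φ t)
        ≤ stepCost ρ n (φ w) * ENNReal.ofReal (t - s) := by
          gcongr; rw [edist_dist]; exact ENNReal.ofReal_le_ofReal hd
      _ = ∫⁻ _ in Ioc s t, stepCost ρ n (φ w) := by
          rw [setLIntegral_const, Real.volume_Ioc]
      _ ≤ ∫⁻ r in Ioc s t, ρ (φ r) :=
          setLIntegral_mono' measurableSet_Ioc fun r hr' => stepCost_le (hr r hr')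
  have hh2 : 2 / ((n : ℝ) + 1) = 2 * h := by rw [hh]; ring
  have hshort : ∀ {s t : ℝ}, 0 ≤ s → s ≤ t → t ≤ L → t - s < h →
      potential ρ G n (φ t) ≤ potential ρ G n (φ s) + ∫⁻ r in Ioc s t, ρ (φ r) ∧
      potential ρ G n (φ s) ≤ potential ρ G n (φ t) + ∫⁻ r in Ioc s t, ρ (φ r) := by
    intro s t hs hst ht hlt
    have hd := hdist hs hst ht
    constructor
    · refine (potential_le_add (hd.trans_lt hlt)).trans ?_
      gcongr
      refine hcost hst hd fun r hr => ?_
      rw [hh2]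
      linarith [hdist hs hr.1.le (hr.2.trans ht), hr.2]
    · refine (potential_le_add (by rw [dist_comm]; exact hd.trans_lt hlt)).trans ?_
      gcongr
      rw [edist_comm]
      refine hcost hst hd fun r hr => ?_
      rw [hh2, dist_comm]
      linarith [hdist (hs.trans hr.1.le) hr.2 ht, hr.1]
  -- Pieces of length `h / 2` keep the strict inequality required of a step.
  have main : ∀ k : ℕ, ∀ {s t : ℝ}, 0 ≤ s → s ≤ t → t ≤ L → t - s ≤ k * (h / 2) →
      potential ρ G n (φ t) ≤ potential ρ G n (φ s) + ∫⁻ r in Ioc s t, ρ (φ r) ∧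
      potential ρ G n (φ s) ≤ potential ρ G n (φ t) + ∫⁻ r in Ioc s t, ρ (φ r) := by
    intro k
    induction k with
    | zero =>
      intro s t hs hst ht hk
      refine hshort hs hst ht ?_
      rw [Nat.cast_zero, zero_mul] at hk
      linarith
    | succ k ih =>
      intro s t hs hst ht hk
      push_cast at hk
      have hm1 : s ≤ min t (s + h / 2) := le_min hst (by linarith)
      have hm2 : min t (s + h / 2) ≤ t := min_le_left _ _
      have h1 := hshort hs hm1 (hm2.trans ht) (by linarith [min_le_right t (s + h / 2)])
      have h2 := ih (hs.trans hm1) hm2 ht (by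
        rcases min_choice t (s + h / 2) with h' | h' <;> rw [h']
        · rw [sub_self]; positivity
        · linarith)
      have hsplit : ∫⁻ r in Ioc s t, ρ (φ r) = (∫⁻ r in Ioc s (min t (s + h / 2)), ρ (φ r)) +
          ∫⁻ r in Ioc (min t (s + h / 2)) t, ρ (φ r) := by
        rw [← lintegral_union measurableSet_Ioc (Ioc_disjoint_Ioc_of_le le_rfl),
          Ioc_union_Ioc_eq_Ioc hm1 hm2]
      rw [hsplit]
      constructor
      · refine h2.1.trans ?_
        rw [← add_assoc]
        gcongr
        exact h1.1
      · refine h1.2.trans ?_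
        rw [add_comm (∫⁻ r in Ioc s _, ρ (φ r)), ← add_assoc]
        gcongr
        exact h2.2
  obtain ⟨k, hk⟩ := exists_nat_gt ((t - s) / (h / 2))
  rw [div_lt_iff₀ (by positivity)] at hk
  exact main k hs hst ht hk.le

theorem isUpperGradient_potential [MeasurableSpace Y] (hρ : Measurable ρ) :
    IsUpperGradient ρ fun x => (potential ρ G n x).toReal := by
  refine ⟨hρ, fun γ hγ => ?_⟩
  have hbv : BoundedVariationOn γ.toFun (Icc γ.a γ.b) := hγ
  set φ := naturalParameterization γ.toFun (Icc γ.a γ.b) γ.a with hφ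
  have hlip := lipschitzOnWith_naturalParameterization γ.le γ.continuousOn hbv
  have h0 : φ 0 = γ.toFun γ.a := by
    have := naturalParameterization_variationOnFromTo (left_mem_Icc.2 γ.le) hbv
    rwa [variationOnFromTo.self] at this
  have hL : φ γ.length.toReal = γ.toFun γ.b := by
    have := naturalParameterization_variationOnFromTo (right_mem_Icc.2 γ.le) hbv
    rwa [variationOnFromTo.eq_of_le _ _ γ.le, inter_self] at this
  obtain ⟨h1, h2⟩ := potential_along_path (ρ := ρ) (G := G) (n := n) hlip le_rfl
    ENNReal.toReal_nonneg le_rfl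
  change potential ρ G n (φ γ.length.toReal) ≤ potential ρ G n (φ 0) + _ at h1
  change potential ρ G n (φ 0) ≤ potential ρ G n (φ γ.length.toReal) + _ at h2
  rw [h0, hL] at h1 h2
  have hI : γ.lineIntegral ρ = ∫⁻ r in Ioc 0 γ.length.toReal, ρ (φ r) :=
    setLIntegral_congr Ioc_ae_eq_Icc.symm
  rw [hI]
  change _ ≤ potential ρ G n (γ.toFun γ.a) + ∫⁻ r in Ioc 0 γ.length.toReal, ρ (φ r) at h1
  change _ ≤ potential ρ G n (γ.toFun γ.b) + ∫⁻ r in Ioc 0 γ.length.toReal, ρ (φ r) at h2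
  set I := ∫⁻ r in Ioc 0 γ.length.toReal, ρ (φ r)
  by_cases hI : I = ∞
  · rw [hI]; exact le_top
  rw [ENNReal.ofReal_le_iff_le_toReal hI, abs_le]
  have h1' := ENNReal.toReal_mono (ENNReal.add_ne_top.2 ⟨potential_ne_top _, hI⟩) h1
  have h2' := ENNReal.toReal_mono (ENNReal.add_ne_top.2 ⟨potential_ne_top _, hI⟩) h2
  rw [ENNReal.toReal_add (potential_ne_top _) hI] at h1' h2'
  constructor <;> linarith

end Potential

/-! ### Limits of chains -/

section Chain

variable {Y : Type*} [MetricSpace Y] {ρ : Y → ℝ≥0∞} {G : Set Y} {n : ℕ}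

/-- A chain is read as a jump path that waits at each vertex for a time equal to the length of the
next step. It is `1`-Lipschitz up to one step, and the integral of the price along it is bounded by
the chain's cost. The last bound limits excursions: beyond distance `R + 2 / (n + 1)` the price is
the full `n`, and one further step accounts for the `3`. -/
theorem ChainTo.exists_path {z y : Y} {s : ℝ≥0∞} {R : ℝ} (h : ChainTo ρ G n z s)
    (hG : G ⊆ Metric.closedBall y R) (hρ : ∀ x, R < dist x y → ρ x = ∞) :
    ∃ (ℓ : ℝ) (φ : ℝ → Y), 0 ≤ ℓ ∧ φ 0 ∈ G ∧ φ ℓ = z ∧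
      (∀ a ∈ Icc 0 ℓ, ∀ b ∈ Icc 0 ℓ, dist (φ a) (φ b) ≤ |a - b| + 1 / ((n : ℝ) + 1)) ∧
      ∫⁻ t in Ioc 0 ℓ, stepCost ρ n (φ t) ≤ s ∧
      ∀ t ∈ Icc 0 ℓ, ENNReal.ofReal (n * (dist (φ t) y - R - 3 / ((n : ℝ) + 1))) ≤ s := by
  have hpos : (0 : ℝ) < 1 / ((n : ℝ) + 1) := by positivity
  induction h with
  | @base x hx =>
    refine ⟨0, fun _ => x, le_rfl, hx, rfl, ?_, by simp, ?_⟩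
    · intro a _ b _
      rw [dist_self]
      positivity
    · intro t _
      rw [ENNReal.ofReal_of_nonpos]
      have : dist x y ≤ R := hG hx
      have h3 : 0 < 3 / ((n : ℝ) + 1) := by positivity
      exact mul_nonpos_of_nonneg_of_nonpos (Nat.cast_nonneg n) (by linarith)
  | @step z z' s h hd ih =>
    obtain ⟨ℓ, φ, hℓ, h0, hz, hlip, hint, hpt⟩ := ih
    set d := dist z z' with hdd
    have hd0 : 0 ≤ d := dist_nonneg
    set ψ : ℝ → Y := fun t => if t < ℓ + d then (if t ≤ ℓ then φ t else z) else z' with hψ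
    have hψ1 : ∀ t ≤ ℓ, ψ t = φ t := by
      intro t ht
      simp only [hψ, ht, if_true]
      by_cases htd : t < ℓ + d
      · rw [if_pos htd]
      · have h1 : d = 0 := by linarith
        have h2 : t = ℓ := by linarith
        rw [if_neg htd, h2, hz]
        exact (dist_eq_zero.1 (hdd ▸ h1)).symm
    have hψ2 : ∀ t ∈ Ioo ℓ (ℓ + d), ψ t = z := by
      intro t ht
      simp only [hψ, ht.2, if_true, not_le.2 ht.1, if_false]
    have hψ3 : ψ (ℓ + d) = z' := by simp only [hψ, lt_irrefl, if_false]
    have hcases : ∀ t ∈ Icc 0 (ℓ + d), t ∈ Icc 0 ℓ ∨ t ∈ Ioo ℓ (ℓ + d) ∨ t = ℓ + d := by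
      intro t ht
      rcases le_or_gt t ℓ with h1 | h1
      · exact Or.inl ⟨ht.1, h1⟩
      · rcases lt_or_eq_of_le ht.2 with h2 | h2
        · exact Or.inr (Or.inl ⟨h1, h2⟩)
        · exact Or.inr (Or.inr h2)
    refine ⟨ℓ + d, ψ, by linarith, by rwa [hψ1 0 hℓ], hψ3, ?_, ?_, ?_⟩
    · have key : ∀ a ∈ Icc 0 (ℓ + d), ∀ b ∈ Icc 0 (ℓ + d), a ≤ b →
          dist (ψ a) (ψ b) ≤ (b - a) + 1 / ((n : ℝ) + 1) := by
        intro a ha b hb hab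
        have hend : ∀ c ∈ Icc 0 ℓ, dist (φ c) z ≤ ℓ - c + 1 / ((n : ℝ) + 1) := by
          intro c hc
          have := hlip c hc ℓ ⟨hℓ, le_rfl⟩
          rwa [hz, abs_sub_comm, abs_of_nonneg (by linarith [hc.2])] at this
        rcases hcases b hb with hb' | hb' | hb'
        · have ha' : a ∈ Icc 0 ℓ := ⟨ha.1, hab.trans hb'.2⟩
          rw [hψ1 a ha'.2, hψ1 b hb'.2]
          have := hlip a ha' b hb'
          rwa [abs_sub_comm, abs_of_nonneg (by linarith)] at this
        · rw [hψ2 b hb']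
          rcases hcases a ha with ha' | ha' | ha'
          · rw [hψ1 a ha'.2]
            linarith [hend a ha', hb'.1]
          · rw [hψ2 a ha', dist_self]; linarith
          · linarith [hb'.2]
        · rw [hb', hψ3]
          rcases hcases a ha with ha' | ha' | ha'
          · rw [hψ1 a ha'.2]
            linarith [hend a ha', dist_triangle (φ a) z z']
          · rw [hψ2 a ha']; linarith [ha'.2]
          · rw [ha', hψ3, dist_self]; linarith
      intro a ha b hb
      rcases le_total a b with hab | hab
      · rw [abs_sub_comm, abs_of_nonneg (by linarith)]
        exact key a ha b hb hab
      · rw [abs_of_nonneg (by linarith), dist_comm]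
        exact key b hb a ha hab
    · rw [← Ioc_union_Ioc_eq_Ioc hℓ (by linarith : ℓ ≤ ℓ + d),
        lintegral_union measurableSet_Ioc (Ioc_disjoint_Ioc_of_le le_rfl)]
      refine add_le_add (le_trans (le_of_eq ?_) hint) (le_of_eq ?_)
      · exact setLIntegral_congr_fun measurableSet_Ioc fun t ht => by simp only [hψ1 t ht.2]
      · calc ∫⁻ t in Ioc ℓ (ℓ + d), stepCost ρ n (ψ t)
            = ∫⁻ t in Ioo ℓ (ℓ + d), stepCost ρ n (ψ t) :=
              setLIntegral_congr Ioo_ae_eq_Ioc.symm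
          _ = ∫⁻ t in Ioo ℓ (ℓ + d), stepCost ρ n z :=
              setLIntegral_congr_fun measurableSet_Ioo fun t ht => by simp only [hψ2 t ht]
          _ = stepCost ρ n z * edist z z' := by
              rw [setLIntegral_const, Real.volume_Ioo, edist_dist, add_sub_cancel_left]
    · intro t ht
      have hz0 := hpt ℓ ⟨hℓ, le_rfl⟩
      rw [hz] at hz0
      rcases hcases t ht with ht' | ht' | ht'
      · rw [hψ1 t ht'.2]; exact (hpt t ht').trans le_self_add
      · rw [hψ2 t ht']; exact hz0.trans le_self_add
      · rw [ht', hψ3]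
        have htri := dist_triangle_left z' y z
        rw [← hdd] at htri
        by_cases hfar : dist z y ≤ R + 2 / ((n : ℝ) + 1)
        · rw [ENNReal.ofReal_of_nonpos]
          · exact zero_le
          refine mul_nonpos_of_nonneg_of_nonpos (Nat.cast_nonneg n) ?_
          have : 3 / ((n : ℝ) + 1) = 2 / ((n : ℝ) + 1) + 1 / ((n : ℝ) + 1) := by ring
          linarith
        · push Not at hfar
          have hc : stepCost ρ n z = n := by
            refine le_antisymm (stepCost_le_nat z) (le_min le_rfl (le_iInf₂ fun w hw => ?_))
            rw [hρ w]
            · exact le_top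
            · rw [Metric.mem_ball'] at hw
              linarith [dist_triangle z w y]
          calc ENNReal.ofReal (n * (dist z' y - R - 3 / ((n : ℝ) + 1)))
              ≤ ENNReal.ofReal (n * (dist z y - R - 3 / ((n : ℝ) + 1)) + n * d) := by
                apply ENNReal.ofReal_le_ofReal
                rw [← mul_add]
                exact mul_le_mul_of_nonneg_left (by linarith) (Nat.cast_nonneg n)
            _ ≤ ENNReal.ofReal (n * (dist z y - R - 3 / ((n : ℝ) + 1))) + ENNReal.ofReal (n * d) :=
                ENNReal.ofReal_add_le
            _ ≤ s + stepCost ρ n z * edist z z' := by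
                refine add_le_add hz0 (le_of_eq ?_)
                rw [hc, edist_dist, ENNReal.ofReal_mul (Nat.cast_nonneg n), ENNReal.ofReal_natCast]

/-- An Arzelà–Ascoli argument for jump paths. The lower bound `e` on `ρ` bounds their lengths by `1
/ e`, and the value `∞` off the ball of radius `R` confines them to a compact ball for large `n`.
The limit is `1`-Lipschitz because the jumps shrink. -/
theorem exists_path_of_potential_lt_one [MeasurableSpace Y] [BorelSpace Y]
    (hρ : LowerSemicontinuous ρ) {e : ℝ} (he : 0 < e) (hρe : ∀ x, ENNReal.ofReal e ≤ ρ x)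
    {y : Y} {R R' : ℝ} (hRR' : R < R') (hK : IsCompact (Metric.closedBall y R'))
    (hρR : ∀ x, R < dist x y → ρ x = ∞) (hGc : IsClosed G) (hG : G ⊆ Metric.closedBall y R)
    {z : Y} (hz : ∀ n, potential ρ G n z < 1) :
    ∃ (ℓ : ℝ) (φ : ℝ → Y), 0 ≤ ℓ ∧ LipschitzWith 1 φ ∧ φ 0 ∈ G ∧ φ ℓ = z ∧
      ∫⁻ t in Icc 0 ℓ, ρ (φ t) ≤ 2 := by
  have hch : ∀ n, ∃ s < 1, ChainTo ρ G n z s := by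
    intro n
    have := hz n
    rw [potential, min_lt_iff] at this
    simpa [iInf_lt_iff, and_comm] using this
  choose s hs1 hs using hch
  choose ℓ φ hℓ h0 hend hlip hint hpt using fun n => (hs n).exists_path hG hρR
  set L : ℝ := 1 / e with hL
  have hLpos : 0 < L := by positivity
  -- lengths are bounded
  have hlen : ∀ᶠ n in atTop, ℓ n ≤ L := by
    obtain ⟨N, hN⟩ := exists_nat_gt e
    filter_upwards [eventually_ge_atTop N] with n hn
    have hcost : ∀ x, ENNReal.ofReal e ≤ stepCost ρ n x := by
      intro x
      refine le_min ?_ (le_iInf₂ fun w _ => hρe w)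
      rw [← ENNReal.ofReal_natCast]
      refine ENNReal.ofReal_le_ofReal (hN.le.trans (by exact_mod_cast hn))
    have h1 : ENNReal.ofReal e * ENNReal.ofReal (ℓ n) ≤ 1 := by
      calc ENNReal.ofReal e * ENNReal.ofReal (ℓ n) = ∫⁻ _ in Ioc 0 (ℓ n), ENNReal.ofReal e := by
            rw [setLIntegral_const, Real.volume_Ioc, sub_zero]
        _ ≤ ∫⁻ t in Ioc 0 (ℓ n), stepCost ρ n (φ n t) := lintegral_mono fun t => hcost _
        _ ≤ 1 := (hint n).trans (hs1 n).le
    rw [← ENNReal.ofReal_mul he.le, ENNReal.ofReal_le_one] at h1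
    rw [hL, le_div_iff₀ he, mul_comm]
    exact h1
  have hinK : ∀ᶠ n in atTop, ∀ t ∈ Icc 0 (ℓ n), φ n t ∈ Metric.closedBall y R' := by
    have hlim : Tendsto (fun n : ℕ => 3 * (1 / ((n : ℝ) + 1)) + 1 / (n : ℝ)) atTop
        (𝓝 (3 * 0 + 0)) :=
      (tendsto_one_div_add_atTop_nhds_zero_nat.const_mul 3).add
        tendsto_one_div_atTop_nhds_zero_nat
    rw [mul_zero, add_zero] at hlim
    filter_upwards [hlim.eventually (gt_mem_nhds (sub_pos.2 hRR')), eventually_gt_atTop 0]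
      with n hn hn0 t ht
    have h1 := (hpt n t ht).trans (hs1 n).le
    rw [ENNReal.ofReal_le_one] at h1
    have hn0' : (0 : ℝ) < n := by exact_mod_cast hn0
    have h2 : dist (φ n t) y - R - 3 / ((n : ℝ) + 1) ≤ 1 / n := by
      rw [le_div_iff₀ hn0', mul_comm]; exact h1
    have h3 : 3 / ((n : ℝ) + 1) = 3 * (1 / ((n : ℝ) + 1)) := by ring
    rw [Metric.mem_closedBall]
    linarith
  -- extend the approximate paths to `ℝ` by constants
  set ψ : ℕ → ℝ → Y := fun n t => φ n (projIcc 0 (ℓ n) (hℓ n) t) with hψ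
  have hψmem : ∀ n t, ((projIcc 0 (ℓ n) (hℓ n) t : ℝ)) ∈ Icc 0 (ℓ n) := fun n t => Subtype.coe_prop _
  have hψlip : ∀ n a b, dist (ψ n a) (ψ n b) ≤ |a - b| + 1 / ((n : ℝ) + 1) := by
    intro n a b
    refine (hlip n _ (hψmem n a) _ (hψmem n b)).trans ?_
    exact add_le_add (abs_projIcc_sub_projIcc (hℓ n)) le_rfl
  -- A nonprincipal ultrafilter provides the limits at all times, and of the lengths,
  -- simultaneously.
  set U : Ultrafilter ℕ := hyperfilter ℕ
  have hU : (U : Filter ℕ) ≤ atTop := Nat.hyperfilter_le_atTop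
  have hh0 : Tendsto (fun n : ℕ => 1 / ((n : ℝ) + 1)) U (𝓝 0) :=
    tendsto_one_div_add_atTop_nhds_zero_nat.mono_left hU
  have hlimψ : ∀ t, ∃ x, Tendsto (fun n => ψ n t) U (𝓝 x) := by
    intro t
    have hmem : ∀ᶠ n in (U : Filter ℕ), ψ n t ∈ Metric.closedBall y R' :=
      hU (hinK.mono fun n hn => hn _ (hψmem n t))
    obtain ⟨x, -, hx⟩ := hK.ultrafilter_le_nhds (U.map fun n => ψ n t)
      (by rw [le_principal_iff]; exact hmem)
    exact ⟨x, hx⟩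
  choose f hf using hlimψ
  obtain ⟨l, hlmem, hl⟩ : ∃ l ∈ Icc 0 L, Tendsto ℓ U (𝓝 l) := by
    obtain ⟨l, hl, hl'⟩ := (isCompact_Icc (a := (0 : ℝ)) (b := L)).ultrafilter_le_nhds (U.map ℓ)
      (by
        rw [le_principal_iff]
        exact hU (hlen.mono fun n hn => ⟨hℓ n, hn⟩))
    exact ⟨l, hl, hl'⟩
  have hflip : LipschitzWith 1 f := by
    refine LipschitzWith.of_dist_le_mul fun a b => ?_
    rw [NNReal.coe_one, one_mul, Real.dist_eq]
    have h1 : Tendsto (fun n : ℕ => |a - b| + 1 / ((n : ℝ) + 1)) U (𝓝 (|a - b| + 0)) :=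
      tendsto_const_nhds.add hh0
    rw [add_zero] at h1
    exact le_of_tendsto_of_tendsto' ((hf a).dist (hf b)) h1 fun n => hψlip n a b
  have hf0 : f 0 ∈ G := by
    refine hGc.mem_of_tendsto (hf 0) (Eventually.of_forall fun n => ?_)
    simp only [hψ, projIcc_left]
    exact h0 n
  have hψend : ∀ n, ψ n (ℓ n) = z := by
    intro n
    simp only [hψ, projIcc_right]
    exact hend n
  have habs : Tendsto (fun n => |l - ℓ n|) U (𝓝 0) := by
    have := (tendsto_const_nhds (x := l)).sub hl |>.abs
    rwa [sub_self, abs_zero] at this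
  have hfl : f l = z := by
    refine tendsto_nhds_unique (hf l) ?_
    rw [tendsto_iff_dist_tendsto_zero]
    have h1 : Tendsto (fun n : ℕ => |l - ℓ n| + 1 / ((n : ℝ) + 1)) U (𝓝 (0 + 0)) := habs.add hh0
    rw [add_zero] at h1
    refine squeeze_zero (fun _ => dist_nonneg) (fun n => ?_) h1
    have := hψlip n l (ℓ n)
    rwa [hψend] at this
  -- Pointwise convergence is uniform on compact segments, since the paths are Lipschitz up to a
  -- vanishing error.
  have hunif : ∀ δ : ℝ, 0 < δ → ∀ᶠ n in (U : Filter ℕ), ∀ t ∈ Icc 0 l, dist (f t) (ψ n t) ≤ δ := by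
    intro δ hδ
    obtain ⟨T, -, hTfin, hT⟩ := (isCompact_Icc (a := (0 : ℝ)) (b := l)).finite_cover_balls
      (e := δ / 4) (by positivity)
    have h1 : ∀ᶠ n in (U : Filter ℕ), ∀ t ∈ T, dist (ψ n t) (f t) < δ / 4 :=
      (eventually_all_finite hTfin).2 fun t _ => Metric.tendsto_nhds.1 (hf t) _ (by positivity)
    filter_upwards [h1, hh0.eventually (gt_mem_nhds (by positivity : (0 : ℝ) < δ / 4))]
      with n hn hn' t ht
    obtain ⟨w, hwT, hw⟩ := mem_iUnion₂.1 (hT ht)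
    have e1 := hψlip n w t
    have e2 := hflip.dist_le_mul t w
    rw [NNReal.coe_one, one_mul] at e2
    rw [Metric.mem_ball] at hw
    rw [← Real.dist_eq, dist_comm w] at e1
    have e3 := hn w hwT
    rw [dist_comm] at e3
    linarith [dist_triangle4 (f t) (f w) (ψ n w) (ψ n t)]
  have hbound : ∀ m : ℕ, ∫⁻ t in Icc 0 l, stepCost ρ m (f t) ≤ 2 := by
    intro m
    have hm : ∀ᶠ n in (U : Filter ℕ), (m : ℝ) * |l - ℓ n| < 1 := by
      have := habs.const_mul (m : ℝ)
      rw [mul_zero] at this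
      exact this.eventually (gt_mem_nhds one_pos)
    -- With `m` fixed, `n ≥ 2m + 1` makes the price at scale `m` along the limit at most the price
    -- at scale `n` along the jump path. The cost contributes `1`; the remainder where `ℓ n < l`
    -- contributes at most `m |l - ℓ n| < 1`.
    obtain ⟨n, hn1, hn2, hn3⟩ := (hm.and ((hunif (1 / ((m : ℝ) + 1)) (by positivity)).and
      (hU (eventually_ge_atTop (2 * m + 1))))).exists
    set l' := min l (ℓ n) with hl'
    have hl'0 : 0 ≤ l' := le_min hlmem.1 (hℓ n)
    have hdiff : l - l' ≤ |l - ℓ n| := by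
      rcases min_choice l (ℓ n) with h | h <;> rw [hl', h]
      · rw [sub_self]; positivity
      · exact le_abs_self _
    have hmn : m ≤ n := by omega
    have hle : ∀ t ∈ Ioc 0 l', stepCost ρ m (f t) ≤ stepCost ρ n (φ n t) := by
      intro t ht
      have htl : t ≤ ℓ n := ht.2.trans (min_le_right _ _)
      have heq : ψ n t = φ n t := by
        simp only [hψ]
        rw [projIcc_of_mem (hℓ n) ⟨ht.1.le, htl⟩]
      have hd := hn2 t ⟨ht.1.le, ht.2.trans (min_le_left _ _)⟩
      rw [heq] at hd
      apply stepCost_le_stepCost hmn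
      have h2 : 2 / ((n : ℝ) + 1) ≤ 1 / ((m : ℝ) + 1) := by
        rw [div_le_div_iff₀ (by positivity) (by positivity)]
        have : ((2 * m + 1 : ℕ) : ℝ) ≤ n := by exact_mod_cast hn3
        push_cast at this
        linarith
      have h3 : 2 / ((m : ℝ) + 1) = 1 / ((m : ℝ) + 1) + 1 / ((m : ℝ) + 1) := by ring
      linarith
    calc ∫⁻ t in Icc 0 l, stepCost ρ m (f t)
        = ∫⁻ t in Ioc 0 l, stepCost ρ m (f t) := setLIntegral_congr Ioc_ae_eq_Icc.symm
      _ = (∫⁻ t in Ioc 0 l', stepCost ρ m (f t)) + ∫⁻ t in Ioc l' l, stepCost ρ m (f t) := by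
          rw [← lintegral_union measurableSet_Ioc (Ioc_disjoint_Ioc_of_le le_rfl),
            Ioc_union_Ioc_eq_Ioc hl'0 (min_le_left _ _)]
      _ ≤ 1 + 1 := by
          gcongr
          · calc ∫⁻ t in Ioc 0 l', stepCost ρ m (f t)
                ≤ ∫⁻ t in Ioc 0 l', stepCost ρ n (φ n t) := setLIntegral_mono' measurableSet_Ioc hle
              _ ≤ ∫⁻ t in Ioc 0 (ℓ n), stepCost ρ n (φ n t) :=
                  lintegral_mono_set (Ioc_subset_Ioc_right (min_le_right _ _))
              _ ≤ 1 := (hint n).trans (hs1 n).le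
          · calc ∫⁻ t in Ioc l' l, stepCost ρ m (f t)
                ≤ ∫⁻ _ in Ioc l' l, (m : ℝ≥0∞) := lintegral_mono fun t => stepCost_le_nat _
              _ = ENNReal.ofReal (m * (l - l')) := by
                  rw [setLIntegral_const, Real.volume_Ioc, ENNReal.ofReal_mul (Nat.cast_nonneg m),
                    ENNReal.ofReal_natCast]
              _ ≤ 1 := by
                  rw [ENNReal.ofReal_le_one]
                  exact (mul_le_mul_of_nonneg_left hdiff (Nat.cast_nonneg m)).trans hn1.le
      _ = 2 := one_add_one_eq_two
  refine ⟨l, f, hlmem.1, hflip, hf0, hfl, ?_⟩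
  calc ∫⁻ t in Icc 0 l, ρ (f t) = ∫⁻ t in Icc 0 l, ⨆ m, stepCost ρ m (f t) := by
        simp only [iSup_stepCost hρ]
    _ = ⨆ m, ∫⁻ t in Icc 0 l, stepCost ρ m (f t) :=
        lintegral_iSup (fun m => measurable_stepCost.comp hflip.continuous.measurable)
          fun a b hab t => stepCost_mono hab _
    _ ≤ 2 := iSup_le hbound

end Chain

/-! ### Points reached by paths of small `ρ`-length -/

/-- The point `z` is joined to `G` by a `1`-Lipschitz path along which the integral of `ρ` is at
most `c`. -/
def Reached {Y : Type*} [MetricSpace Y] (ρ : Y → ℝ≥0∞) (G : Set Y) (c : ℝ≥0∞) (z : Y) : Prop :=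
  ∃ (ℓ : ℝ) (φ : ℝ → Y), 0 ≤ ℓ ∧ LipschitzWith 1 φ ∧ φ 0 ∈ G ∧ φ ℓ = z ∧
    ∫⁻ t in Icc 0 ℓ, ρ (φ t) ≤ c

theorem Reached.mono {Y : Type*} [MetricSpace Y] {ρ ρ' : Y → ℝ≥0∞} {G G' : Set Y} {c c' : ℝ≥0∞}
    {z : Y} (h : Reached ρ G c z) (hρ : ∀ x, ρ' x ≤ ρ x) (hG : G ⊆ G') (hc : c ≤ c') :
    Reached ρ' G' c' z := by
  obtain ⟨ℓ, φ, h0, hl, hs, he, hi⟩ := h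
  exact ⟨ℓ, φ, h0, hl, hG hs, he, (lintegral_mono fun t => hρ _).trans (hi.trans hc)⟩

theorem Reached.trans {Y : Type*} [MetricSpace Y] {ρ : Y → ℝ≥0∞} {F G : Set Y} {c d : ℝ≥0∞}
    {z : Y} (hG : ∀ w ∈ G, Reached ρ F c w) (hz : Reached ρ G d z) : Reached ρ F (c + d) z := by
  obtain ⟨ℓ₂, φ₂, h0₂, hl₂, hs₂, he₂, hi₂⟩ := hz
  obtain ⟨ℓ₁, φ₁, h0₁, hl₁, hs₁, he₁, hi₁⟩ := hG _ hs₂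
  set φ : ℝ → Y := fun t => if t ≤ ℓ₁ then φ₁ t else φ₂ (t - ℓ₁) with hφ
  have hφ1 : ∀ t ≤ ℓ₁, φ t = φ₁ t := fun t ht => if_pos ht
  have hφ2 : ∀ t, ℓ₁ ≤ t → φ t = φ₂ (t - ℓ₁) := by
    intro t ht
    rcases eq_or_lt_of_le ht with rfl | h
    · rw [hφ1 _ le_rfl, he₁, sub_self]
    · exact if_neg (not_le.2 h)
  have key : ∀ a b, a ≤ b → dist (φ a) (φ b) ≤ b - a := by
    have k1 : ∀ a b, a ≤ b → dist (φ₁ a) (φ₁ b) ≤ b - a := by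
      intro a b hab
      have := hl₁.dist_le_mul a b
      rwa [NNReal.coe_one, one_mul, dist_comm a, Real.dist_eq, abs_of_nonneg (by linarith)] at this
    have k2 : ∀ a b, a ≤ b → dist (φ₂ a) (φ₂ b) ≤ b - a := by
      intro a b hab
      have := hl₂.dist_le_mul a b
      rwa [NNReal.coe_one, one_mul, dist_comm a, Real.dist_eq, abs_of_nonneg (by linarith)] at this
    intro a b hab
    rcases le_total b ℓ₁ with hb | hb
    · rw [hφ1 a (hab.trans hb), hφ1 b hb]; exact k1 a b hab
    · rcases le_total a ℓ₁ with ha | ha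
      · have e1 := k1 a ℓ₁ ha
        have e2 := k2 (ℓ₁ - ℓ₁) (b - ℓ₁) (by linarith)
        rw [← hφ1 a ha, ← hφ1 ℓ₁ le_rfl] at e1
        rw [← hφ2 b hb, ← hφ2 ℓ₁ le_rfl] at e2
        linarith [dist_triangle (φ a) (φ ℓ₁) (φ b)]
      · rw [hφ2 a ha, hφ2 b hb]
        linarith [k2 (a - ℓ₁) (b - ℓ₁) (by linarith)]
  refine ⟨ℓ₁ + ℓ₂, φ, by linarith, ?_, by rwa [hφ1 0 h0₁], ?_, ?_⟩
  · refine LipschitzWith.of_dist_le_mul fun a b => ?_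
    rw [NNReal.coe_one, one_mul, Real.dist_eq]
    rcases le_total a b with h | h
    · rw [abs_sub_comm, abs_of_nonneg (by linarith)]; exact key a b h
    · rw [abs_of_nonneg (by linarith), dist_comm]; exact key b a h
  · rw [hφ2 _ (by linarith), add_sub_cancel_left, he₂]
  · have hsub : Icc 0 (ℓ₁ + ℓ₂) ⊆ Icc 0 ℓ₁ ∪ Icc ℓ₁ (ℓ₁ + ℓ₂) := Icc_subset_Icc_union_Icc
    calc ∫⁻ t in Icc 0 (ℓ₁ + ℓ₂), ρ (φ t)
        ≤ ∫⁻ t in Icc 0 ℓ₁ ∪ Icc ℓ₁ (ℓ₁ + ℓ₂), ρ (φ t) := lintegral_mono_set hsub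
      _ ≤ (∫⁻ t in Icc 0 ℓ₁, ρ (φ t)) + ∫⁻ t in Icc ℓ₁ (ℓ₁ + ℓ₂), ρ (φ t) :=
          lintegral_union_le _ _ _
      _ ≤ c + d := by
          refine add_le_add (le_trans (le_of_eq ?_) hi₁) (le_trans (le_of_eq ?_) hi₂)
          · exact setLIntegral_congr_fun measurableSet_Icc fun t ht => by simp only [hφ1 t ht.2]
          · calc ∫⁻ t in Icc ℓ₁ (ℓ₁ + ℓ₂), ρ (φ t)
                = ∫⁻ t in Icc ℓ₁ (ℓ₁ + ℓ₂), ρ (φ₂ (t - ℓ₁)) :=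
                  setLIntegral_congr_fun measurableSet_Icc fun t ht => by simp only [hφ2 t ht.1]
              _ = ∫⁻ t in (fun t => t - ℓ₁) ⁻¹' Icc 0 ℓ₂, ρ (φ₂ (t - ℓ₁)) := by
                  congr 2
                  ext t
                  simp only [mem_Icc, mem_preimage]
                  constructor <;> rintro ⟨h1, h2⟩ <;> constructor <;> linarith
              _ = ∫⁻ t in Icc 0 ℓ₂, ρ (φ₂ t) :=
                  (measurePreserving_sub_right volume ℓ₁).setLIntegral_comp_preimage_emb
                    (measurableEmbedding_subRight ℓ₁) (fun t => ρ (φ₂ t)) _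

section Transfer

variable {Y : Type*} [MetricSpace Y] [MeasurableSpace Y] [BorelSpace Y]

/-- A Borel function is dominated on `Y` by a lower semicontinuous one that is bounded below by a
positive constant, is infinite off a closed ball, and has nearly the same energy in the ball. -/
theorem exists_lowerSemicontinuous_ge {ν : Measure Y} {p : ℝ} (hp : 1 ≤ p) {y : Y} {R : ℝ}
    (hfin : ν (Metric.ball y R) ≠ ∞) {c : ℝ} (hc : 0 < c) {ρ : Y → ℝ≥0∞} (hρ : Measurable ρ)
    (hρc : ∫⁻ x, ρ x ^ p ∂ν ≤ ENNReal.ofReal (c / 3)) :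
    ∃ (ρ' : Y → ℝ≥0∞) (e : ℝ), LowerSemicontinuous ρ' ∧ (∀ x, ρ x ≤ ρ' x) ∧ 0 < e ∧
      (∀ x, ENNReal.ofReal e ≤ ρ' x) ∧ (∀ x, R < dist x y → ρ' x = ∞) ∧
      ∫⁻ x in Metric.ball y R, ρ' x ^ p ∂ν ≤ ENNReal.ofReal c := by
  have hp0 : 0 < p := by linarith
  -- The energy budget `c` is split in three: `ρ` itself, the constant `e`, and the loss in the
  -- Vitali–Carathéodory theorem.
  obtain ⟨e, he, hec⟩ : ∃ e : ℝ, 0 < e ∧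
      ENNReal.ofReal e ^ p * ν (Metric.ball y R) ≤ ENNReal.ofReal (c / 3) := by
    set V := (ν (Metric.ball y R)).toReal with hV
    have hV0 : 0 ≤ V := ENNReal.toReal_nonneg
    refine ⟨(c / 3 / (V + 1)) ^ (1 / p), by positivity, ?_⟩
    rw [ENNReal.ofReal_rpow_of_nonneg (by positivity) hp0.le, ← Real.rpow_mul (by positivity),
      one_div_mul_cancel hp0.ne', Real.rpow_one, ← ENNReal.ofReal_toReal hfin, ← hV,
      ← ENNReal.ofReal_mul (by positivity)]
    apply ENNReal.ofReal_le_ofReal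
    rw [div_mul_eq_mul_div, div_le_iff₀ (by positivity)]
    nlinarith
  have : IsFiniteMeasure (ν.restrict (Metric.ball y R)) :=
    ⟨by rw [Measure.restrict_apply_univ]; exact hfin.lt_top⟩
  obtain ⟨g, hfg, hg, hgi⟩ := exists_le_lowerSemicontinuous_lintegral_ge
    (ν.restrict (Metric.ball y R)) (fun x => max (ρ x) (ENNReal.ofReal e) ^ p)
    ((hρ.max measurable_const).pow_const p) (ε := ENNReal.ofReal (c / 3))
    (by rw [Ne, ENNReal.ofReal_eq_zero, not_le]; positivity)
  have hgp : ∀ x, max (ρ x) (ENNReal.ofReal e) ≤ g x ^ (1 / p) := by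
    intro x
    rw [← ENNReal.rpow_le_rpow_iff hp0, ← ENNReal.rpow_mul, one_div_mul_cancel hp0.ne',
      ENNReal.rpow_one]
    exact hfg x
  have hglsc : LowerSemicontinuous fun x => g x ^ (1 / p) :=
    (ENNReal.continuous_rpow_const (y := 1 / p)).comp_lowerSemicontinuous hg
      (ENNReal.monotone_rpow_of_nonneg (by positivity))
  set ρ' : Y → ℝ≥0∞ := fun x => if dist x y ≤ R then g x ^ (1 / p) else ∞ with hρ'
  have hge : ∀ x, g x ^ (1 / p) ≤ ρ' x := by
    intro x
    simp only [hρ']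
    split_ifs
    · exact le_rfl
    · exact le_top
  refine ⟨ρ', e, ?_, fun x => (le_max_left _ _).trans ((hgp x).trans (hge x)), he,
    fun x => (le_max_right _ _).trans ((hgp x).trans (hge x)),
    fun x hx => if_neg (not_le.2 hx), ?_⟩
  · intro x b hb
    by_cases hx : dist x y ≤ R
    · have hb' : b < g x ^ (1 / p) := by simpa only [hρ', hx, if_true] using hb
      exact (hglsc x b hb').mono fun w hw => lt_of_lt_of_le hw (hge w)
    · have hopen : IsOpen {w | R < dist w y} :=
        isOpen_lt continuous_const (continuous_id.dist continuous_const)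
      filter_upwards [hopen.mem_nhds (not_le.1 hx)] with w hw
      have hw' : ρ' w = ∞ := if_neg (not_le.2 hw)
      rw [hw']
      exact lt_of_lt_of_le hb le_top
  · calc ∫⁻ x in Metric.ball y R, ρ' x ^ p ∂ν = ∫⁻ x in Metric.ball y R, g x ∂ν := by
          refine setLIntegral_congr_fun Metric.isOpen_ball.measurableSet fun x hx => ?_
          have : ρ' x = g x ^ (1 / p) := if_pos (Metric.mem_ball.1 hx).le
          simp only [this]
          rw [← ENNReal.rpow_mul, one_div_mul_cancel hp0.ne', ENNReal.rpow_one]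
      _ ≤ (∫⁻ x in Metric.ball y R, max (ρ x) (ENNReal.ofReal e) ^ p ∂ν) +
            ENNReal.ofReal (c / 3) := hgi
      _ ≤ (∫⁻ x in Metric.ball y R, (ρ x ^ p + ENNReal.ofReal e ^ p) ∂ν) +
            ENNReal.ofReal (c / 3) := by
          gcongr with x
          rcases max_choice (ρ x) (ENNReal.ofReal e) with h | h <;> rw [h]
          · exact le_self_add
          · exact le_add_self
      _ ≤ (ENNReal.ofReal (c / 3) + ENNReal.ofReal (c / 3)) + ENNReal.ofReal (c / 3) := by
          rw [lintegral_add_right _ measurable_const, setLIntegral_const]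
          gcongr
          exact (setLIntegral_le_lintegral _ _).trans hρc
      _ = ENNReal.ofReal c := by
          rw [← ENNReal.ofReal_add (by positivity) (by positivity),
            ← ENNReal.ofReal_add (by positivity) (by positivity)]
          congr 1
          ring

/-- If every continuous function with small energy that vanishes on `F` is small on most of `B`,
then most of `B` is joined to `F` by paths of small `ρ`-length. -/
theorem exists_reached_of_energy {ν : Measure Y} {p : ℝ} (hp : 1 ≤ p) {y : Y} {R R' : ℝ}
    (hRR' : R < R') (hK : IsCompact (Metric.closedBall y R'))
    (hfin : ν (Metric.ball y R) ≠ ∞) {c : ℝ} (hc : 0 < c) {F B : Set Y} {t : ℝ≥0∞}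
    (hFc : IsClosed F) (hF : F ⊆ Metric.closedBall y R) (hB : B ⊆ Metric.closedBall y R)
    (H : ∀ (u : Y → ℝ) (ρ : Y → ℝ≥0∞), Continuous u → (∀ x, 0 ≤ u x) → (∀ x, u x ≤ 1) →
      (∀ x ∈ F, u x = 0) → IsUpperGradient ρ u →
      ∫⁻ x in Metric.ball y R, ρ x ^ p ∂ν ≤ ENNReal.ofReal c → ν {x ∈ B | 1 / 2 ≤ u x} ≤ t)
    {ρ : Y → ℝ≥0∞} (hρ : Measurable ρ) (hρc : ∫⁻ x, ρ x ^ p ∂ν ≤ ENNReal.ofReal (c / 3)) :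
    ∃ G : Set Y, IsClosed G ∧ ν (B \ G) ≤ t ∧ ∀ z ∈ G, Reached ρ F 2 z := by
  obtain ⟨ρ', e, hlsc, hle, he, hρe, hρR, hint⟩ := exists_lowerSemicontinuous_ge hp hfin hc hρ hρc
  set u : ℕ → Y → ℝ := fun n x => (potential ρ' F n x).toReal with hu
  have huc : ∀ n, Continuous (u n) := fun n => continuous_potential
  refine ⟨Metric.closedBall y R ∩ ⋂ n, {x | u n x ≤ 1 / 2}, ?_, ?_, ?_⟩
  · exact Metric.isClosed_closedBall.inter
      (isClosed_iInter fun n => isClosed_le (huc n) continuous_const)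
  · have hsub : B \ (Metric.closedBall y R ∩ ⋂ n, {x | u n x ≤ 1 / 2}) ⊆
        ⋃ n, {x ∈ B | 1 / 2 ≤ u n x} := by
      rintro x ⟨hxB, hx⟩
      by_contra hcon
      refine hx ⟨hB hxB, mem_iInter.2 fun n => ?_⟩
      by_contra hn
      exact hcon (mem_iUnion.2 ⟨n, hxB, (not_le.1 hn).le⟩)
    refine (measure_mono hsub).trans ?_
    -- The exceptional sets grow with `n`, so the bound `t` for each of them passes to their union
    -- without loss.
    have hmono : Monotone fun n => {x ∈ B | 1 / 2 ≤ u n x} := by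
      intro m n hmn x hx
      exact ⟨hx.1, hx.2.trans (ENNReal.toReal_mono (potential_ne_top x) (potential_mono hmn x))⟩
    rw [hmono.measure_iUnion]
    refine iSup_le fun n => H (u n) ρ' (huc n) (fun x => ENNReal.toReal_nonneg) (fun x => ?_)
      (fun x hx => ?_) (isUpperGradient_potential hlsc.measurable) hint
    · exact ENNReal.toReal_le_of_le_ofReal zero_le_one (by simpa using potential_le_one x)
    · simp only [hu, potential_eq_zero hx, ENNReal.toReal_zero]
  · rintro z ⟨-, hz⟩
    have hz' : ∀ n, potential ρ' F n z < 1 := by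
      intro n
      have h1 : u n z ≤ 1 / 2 := mem_iInter.1 hz n
      rw [← ENNReal.toReal_lt_toReal (potential_ne_top z) ENNReal.one_ne_top, ENNReal.toReal_one]
      exact lt_of_le_of_lt h1 (by norm_num)
    obtain ⟨ℓ, φ, h0, hl, hs, hend, hi⟩ :=
      exists_path_of_potential_lt_one hlsc he hρe hRR' hK hρR hFc hF hz'
    exact Reached.mono ⟨ℓ, φ, h0, hl, hs, hend, hi⟩ hle Subset.rfl le_rfl

end Transfer

/-! ### Poincaré inequality with explicit constants -/

/-- Ahlfors `α`-regularity and the `(1; p)`-Poincaré inequality for balls of radius at most `r₁`,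
with explicit constants, for continuous functions with values in `[0, 1]`. -/
structure PoincareData {Y : Type*} [MetricSpace Y] [MeasurableSpace Y] (ν : Measure Y)
    (α p c C K τ r₁ : ℝ) : Prop where
  c_pos : 0 < c
  C_pos : 0 < C
  K_pos : 0 < K
  one_le_tau : 1 ≤ τ
  r₁_pos : 0 < r₁
  ball_lt_top : ∀ x r, ν (Metric.ball x r) < ∞
  lower : ∀ x r, 0 < r → r ≤ r₁ → c * r ^ α ≤ ν.real (Metric.ball x r)
  upper : ∀ x r, 0 < r → r ≤ r₁ → ν.real (Metric.ball x r) ≤ C * r ^ α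
  poincare : ∀ (u : Y → ℝ) (ρ : Y → ℝ≥0∞), Continuous u → (∀ x, 0 ≤ u x) → (∀ x, u x ≤ 1) →
    IsUpperGradient ρ u → ∀ x r I, 0 < r → r ≤ r₁ → 0 ≤ I →
      ∫⁻ y in Metric.ball x (τ * r), ρ y ^ p ∂ν ≤ ENNReal.ofReal I →
        ∫ y in Metric.ball x r, |u y - ⨍ z in Metric.ball x r, u z ∂ν| ∂ν ≤
          ν.real (Metric.ball x r) * (K * (r ^ (p - α) * I) ^ (1 / p))

section

variable {Y : Type*} [MetricSpace Y] [MeasurableSpace Y] {ν : Measure Y} {α p c C K τ r₁ : ℝ}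

theorem PoincareData.measureReal_ball_pos (h : PoincareData ν α p c C K τ r₁) (x : Y) {r : ℝ}
    (hr : 0 < r) : 0 < ν.real (Metric.ball x r) := by
  have h1 : 0 < min r r₁ := lt_min hr h.r₁_pos
  have h2 := h.lower x _ h1 (min_le_right _ _)
  have h3 : 0 < c * (min r r₁) ^ α := mul_pos h.c_pos (Real.rpow_pos_of_pos h1 _)
  exact (h3.trans_le h2).trans_le
    (measureReal_mono (Metric.ball_subset_ball (min_le_left _ _)) (h.ball_lt_top x r).ne)

theorem PoincareData.exists_energy (h : PoincareData ν α p c C K τ r₁) (hp : 1 ≤ p) {r ε : ℝ}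
    (hr : 0 < r) (hε : 0 < ε) : ∃ I : ℝ, 0 < I ∧ K * (r ^ (p - α) * I) ^ (1 / p) ≤ ε := by
  have hK := h.K_pos
  refine ⟨(ε / K) ^ p / r ^ (p - α), by positivity, ?_⟩
  rw [mul_div_cancel₀ _ (by positivity), ← Real.rpow_mul (by positivity),
    mul_one_div_cancel (by linarith), Real.rpow_one, mul_div_cancel₀ _ hK.ne']

end

section

variable {Y : Type*} [MetricSpace Y] [MeasurableSpace Y] [BorelSpace Y]

theorem integrableOn_ball_of_continuous_of_bounded {ν : Measure Y} {u : Y → ℝ}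
    (hu : Continuous u) (h0 : ∀ x, 0 ≤ u x) (h1 : ∀ x, u x ≤ 1) {x : Y} {r : ℝ}
    (hfin : ν (Metric.ball x r) < ∞) : IntegrableOn u (Metric.ball x r) ν := by
  refine IntegrableOn.of_bound hfin (hu.measurable.aestronglyMeasurable) 1 ?_
  filter_upwards with y
  rw [Real.norm_eq_abs, abs_of_nonneg (h0 y)]
  exact h1 y

/-- Two distinct points give a positive radius below the diameter, so that Ahlfors regularity
applies to all small balls and turns averages in the Poincaré inequality into powers of `r`. -/
theorem exists_poincareData [Nontrivial Y] {ν : Measure Y} {α p : ℝ}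
    (hp : 1 ≤ p) (hfin : ∀ x r, ν (Metric.ball x r) < ∞) (hreg : AhlforsRegular ν α)
    (hpoin : SupportsPoincare ν p) :
    ∃ c C K τ r₁ : ℝ, PoincareData ν α p c C K τ r₁ := by
  obtain ⟨C₀, hC₀, hreg⟩ := hreg
  obtain ⟨C₁, hC₁, τ₀, hτ₀, hpoin⟩ := hpoin
  have hC₀' : 0 < C₀ := by linarith
  have hp0 : 0 < p := by linarith
  obtain ⟨R₀, hR₀, hR₀d⟩ : ∃ R₀ : ℝ, 0 < R₀ ∧
      ENNReal.ofReal R₀ ≤ Metric.ediam (univ : Set Y) := by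
    obtain ⟨a, b, hab⟩ := exists_pair_ne Y
    refine ⟨dist a b, dist_pos.2 hab, ?_⟩
    rw [← edist_dist]
    exact Metric.edist_le_ediam_of_mem (mem_univ a) (mem_univ b)
  set τ := max τ₀ 1 with hτ
  have hτ1 : 1 ≤ τ := le_max_right _ _
  have hτpos : 0 < τ := by linarith
  have hr : ∀ x r, 0 < r → r ≤ R₀ → r ^ α / C₀ ≤ ν.real (Metric.ball x r) ∧
      ν.real (Metric.ball x r) ≤ C₀ * r ^ α := by
    intro x r hr0 hrR
    obtain ⟨h1, h2⟩ := hreg x r hr0 ((ENNReal.ofReal_le_ofReal hrR).trans hR₀d)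
    constructor
    · have := ENNReal.toReal_mono (hfin x r).ne h1
      rwa [ENNReal.toReal_ofReal (by positivity)] at this
    · exact ENNReal.toReal_le_of_le_ofReal (by positivity) h2
  have hsmall : R₀ / τ ≤ R₀ := div_le_self hR₀.le hτ1
  -- The radius `R₀ / τ` keeps both `r` and `τ₀ * r` in the range of regularity. In `K`, the `2`
  -- comes from the diameter of the ball and the power from the lower bound for the measure of the
  -- ball of radius `τ₀ * r`.
  refine ⟨1 / C₀, C₀, C₁ * 2 * (C₀ / τ₀ ^ α) ^ (1 / p), τ, R₀ / τ, by positivity, by positivity,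
    by positivity, hτ1, by positivity, hfin, ?_, ?_, ?_⟩
  · intro x r hr0 hrR
    have := (hr x r hr0 (hrR.trans hsmall)).1
    rwa [div_eq_inv_mul, ← one_div] at this
  · intro x r hr0 hrR
    exact (hr x r hr0 (hrR.trans hsmall)).2
  · intro u ρ hu h0 h1 hgrad x r I hr0 hrR hI hint
    have hB := integrableOn_ball_of_continuous_of_bounded (ν := ν) hu h0 h1 (hfin x r)
    have hmain := hpoin u hu ρ hgrad x r hr0 hB
    set m := ⨍ z in Metric.ball x r, u z ∂ν with hm
    have hτr : τ₀ * r ≤ R₀ := by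
      rw [le_div_iff₀ hτpos] at hrR
      nlinarith [le_max_left τ₀ 1]
    have hlow := (hr x (τ₀ * r) (by positivity) hτr).1
    have hlow' : ENNReal.ofReal ((τ₀ * r) ^ α / C₀) ≤ ν (Metric.ball x (τ₀ * r)) := by
      rw [← ofReal_measureReal (hfin _ _).ne]
      exact ENNReal.ofReal_le_ofReal hlow
    have hlowpos : 0 < (τ₀ * r) ^ α / C₀ := by positivity
    have havg : (⨍⁻ y in Metric.ball x (τ₀ * r), ρ y ^ p ∂ν) ≤
        ENNReal.ofReal (I / ((τ₀ * r) ^ α / C₀)) := by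
      rw [setLAverage_eq, ENNReal.ofReal_div_of_pos hlowpos]
      refine ENNReal.div_le_div (le_trans (lintegral_mono_set ?_) hint) hlow'
      exact Metric.ball_subset_ball (by gcongr; exact le_max_left _ _)
    have hdiam : Metric.ediam (Metric.ball x r) ≤ ENNReal.ofReal (2 * r) := by
      refine Metric.ediam_le fun a ha b hb => ?_
      rw [edist_dist]
      apply ENNReal.ofReal_le_ofReal
      rw [Metric.mem_ball] at ha hb
      linarith [dist_triangle_right a b x]
    have hposI : 0 ≤ I / ((τ₀ * r) ^ α / C₀) := by positivity
    have hrhs : ENNReal.ofReal C₁ * Metric.ediam (Metric.ball x r) *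
        (⨍⁻ y in Metric.ball x (τ₀ * r), ρ y ^ p ∂ν) ^ (1 / p) ≤
        ENNReal.ofReal (C₁ * (2 * r) * (I / ((τ₀ * r) ^ α / C₀)) ^ (1 / p)) := by
      rw [ENNReal.ofReal_mul (by positivity), ENNReal.ofReal_mul (by positivity),
        ← ENNReal.ofReal_rpow_of_nonneg hposI (by positivity)]
      gcongr
    have h3 := ENNReal.toReal_le_of_le_ofReal (by positivity) (hmain.trans hrhs)
    have hν : ν (Metric.ball x r) ≠ 0 := by
      intro h
      have := (hr x r hr0 (hrR.trans hsmall)).1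
      rw [Measure.real, h, ENNReal.toReal_zero] at this
      have h5 : 0 < r ^ α / C₀ := by positivity
      linarith
    have hνr : 0 < ν.real (Metric.ball x r) := ENNReal.toReal_pos hν (hfin x r).ne
    rw [setLAverage_eq, ENNReal.toReal_div, ← integral_eq_lintegral_of_nonneg_ae
      (f := fun y => |u y - m|) (Eventually.of_forall fun y => abs_nonneg _)
      (hu.sub continuous_const).abs.measurable.aestronglyMeasurable] at h3
    change _ / ν.real _ ≤ _ at h3
    rw [div_le_iff₀ hνr, mul_comm] at h3
    refine h3.trans (le_of_eq ?_)
    congr 1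
    have e1 : r ^ (p - α) * I = r ^ p * (I / r ^ α) := by
      rw [Real.rpow_sub hr0]; field_simp
    have e2 : I / ((τ₀ * r) ^ α / C₀) = (C₀ / τ₀ ^ α) * (I / r ^ α) := by
      rw [Real.mul_rpow hτ₀.le hr0.le]
      field_simp
    rw [e1, e2, Real.mul_rpow (by positivity) (by positivity),
      Real.mul_rpow (by positivity) (by positivity), ← Real.rpow_mul hr0.le,
      mul_one_div_cancel hp0.ne', Real.rpow_one]
    ring

variable {ν : Measure Y} {α p c C K τ r₁ : ℝ}

/-- Markov's inequality for the mean value. -/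
theorem PoincareData.measureReal_le_average (h : PoincareData ν α p c C K τ r₁) {u : Y → ℝ}
    (hu : Continuous u) (h0 : ∀ x, 0 ≤ u x) (h1 : ∀ x, u x ≤ 1) {x : Y} {r : ℝ} (hr : 0 < r) :
    ν.real {y ∈ Metric.ball x r | 1 / 2 ≤ u y} ≤
      2 * (⨍ y in Metric.ball x r, u y ∂ν) * ν.real (Metric.ball x r) := by
  have hB := integrableOn_ball_of_continuous_of_bounded (ν := ν) hu h0 h1 (h.ball_lt_top x r)
  have hmk := mul_meas_ge_le_integral_of_nonneg (μ := ν.restrict (Metric.ball x r))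
    (Eventually.of_forall h0) hB (1 / 2)
  have hset : (ν.restrict (Metric.ball x r)).real {y | 1 / 2 ≤ u y} =
      ν.real {y ∈ Metric.ball x r | 1 / 2 ≤ u y} := by
    rw [measureReal_restrict_apply' Metric.isOpen_ball.measurableSet, inter_comm]
    rfl
  rw [hset] at hmk
  have hpos := h.measureReal_ball_pos x hr
  rw [setAverage_eq, smul_eq_mul]
  rw [show ∀ J : ℝ, 2 * ((ν.real (Metric.ball x r))⁻¹ * J) * ν.real (Metric.ball x r) = 2 * J from
    fun J => by field_simp]
  linarith

/-- A function that vanishes on a definite part of a ball and has small energy is small on most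
of the ball. -/
theorem PoincareData.measureReal_le_of_vanishing (h : PoincareData ν α p c C K τ r₁) {u : Y → ℝ}
    {ρ : Y → ℝ≥0∞} (hu : Continuous u) (h0 : ∀ x, 0 ≤ u x) (h1 : ∀ x, u x ≤ 1)
    (hgrad : IsUpperGradient ρ u) {G : Set Y} (hG : IsClosed G) (hGu : ∀ x ∈ G, u x = 0)
    {x : Y} {r I : ℝ} (hr : 0 < r) (hrr : r ≤ r₁) (hI : 0 ≤ I)
    (hint : ∫⁻ y in Metric.ball x (τ * r), ρ y ^ p ∂ν ≤ ENNReal.ofReal I)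
    (hGB : G ⊆ Metric.ball x r) {θ : ℝ} (hθ : 0 < θ) (hθG : θ ≤ ν.real G) :
    ν.real {y ∈ Metric.ball x r | 1 / 2 ≤ u y} ≤
      2 * ν.real (Metric.ball x r) ^ 2 / θ * (K * (r ^ (p - α) * I) ^ (1 / p)) := by
  have hP := h.poincare u ρ hu h0 h1 hgrad x r I hr hrr hI hint
  have hM := h.measureReal_le_average hu h0 h1 (x := x) hr
  have hpos := h.measureReal_ball_pos x hr
  set m := ⨍ y in Metric.ball x r, u y ∂ν with hm
  set e := K * (r ^ (p - α) * I) ^ (1 / p) with he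
  set V := ν.real (Metric.ball x r) with hV
  have hm0 : 0 ≤ m := by
    rw [hm, setAverage_eq, smul_eq_mul]
    exact mul_nonneg (by positivity) (integral_nonneg fun y => h0 y)
  have hB := integrableOn_ball_of_continuous_of_bounded (ν := ν) hu h0 h1 (h.ball_lt_top x r)
  have hdiff : IntegrableOn (fun y => |u y - m|) (Metric.ball x r) ν := by
    have hfin : IsFiniteMeasure (ν.restrict (Metric.ball x r)) :=
      ⟨by rw [Measure.restrict_apply_univ]; exact h.ball_lt_top x r⟩
    exact (hB.sub (integrable_const m)).abs
  -- On `G` the deviation from the mean is the mean itself.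
  have h2 : m * ν.real G ≤ V * e := by
    calc m * ν.real G = ∫ y in G, |u y - m| ∂ν := by
          rw [setIntegral_congr_fun hG.measurableSet (g := fun _ => m), setIntegral_const,
            smul_eq_mul, mul_comm]
          intro y hy
          simp only [hGu y hy, zero_sub, abs_neg, abs_of_nonneg hm0]
      _ ≤ ∫ y in Metric.ball x r, |u y - m| ∂ν :=
          setIntegral_mono_set hdiff (Eventually.of_forall fun y => abs_nonneg _)
            hGB.eventuallyLE
      _ ≤ V * e := hP
  have h3 : m ≤ V * e / θ := by
    rw [le_div_iff₀ hθ]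
    exact (mul_le_mul_of_nonneg_left hθG hm0).trans h2
  calc _ ≤ 2 * m * V := hM
    _ ≤ 2 * (V * e / θ) * V := by gcongr
    _ = _ := by ring

end

/-! ### Functions vanishing on a continuum -/

/-- If every drop were smaller than the corresponding term of a geometric series of sum `m₀`, the
total drop could not exceed `m₀`. -/
theorem exists_geometric_le_sub {m : ℕ → ℝ} (hm : Tendsto m atTop (𝓝 0)) {m₀ q : ℝ}
    (hm₀ : 0 < m₀) (h0 : m₀ < m 0) (hq0 : 0 < q) : ∃ i, m₀ * (1 - q) * q ^ i ≤ m i - m (i + 1) := by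
  by_contra! hcon
  have hsum : ∀ k, m 0 - m k ≤ m₀ * (1 - q ^ k) := by
    intro k
    induction k with
    | zero => simp
    | succ k ih =>
      have := hcon k
      rw [pow_succ]
      nlinarith
  have hle : ∀ k, m 0 - m k ≤ m₀ := fun k =>
    (hsum k).trans (by nlinarith [pow_pos hq0 k])
  have := le_of_tendsto' (tendsto_const_nhds.sub hm) hle
  linarith

/-- If a segment is covered by the distances to `x₀` from points of finitely many balls, then the
sum of the diameters of the balls is at least the length of the segment. -/
theorem le_sum_of_dist_cover {Y : Type*} [PseudoMetricSpace Y] {x₀ : Y} {L : ℝ} {F : Set Y}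
    (hF : ∀ t ∈ Icc 0 L, ∃ z ∈ F, dist z x₀ = t) {ι : Type*} (T : Finset ι) (z : ι → Y) (r : ι → ℝ)
    (hr : ∀ b ∈ T, 0 ≤ r b) (hcov : F ⊆ ⋃ b ∈ T, Metric.closedBall (z b) (r b)) :
    L ≤ ∑ b ∈ T, 2 * r b := by
  have hsub : Icc 0 L ⊆ ⋃ b ∈ T, Icc (dist (z b) x₀ - r b) (dist (z b) x₀ + r b) := by
    intro t ht
    obtain ⟨w, hw, rfl⟩ := hF t ht
    obtain ⟨b, hb, hwb⟩ := mem_iUnion₂.1 (hcov hw)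
    rw [Metric.mem_closedBall] at hwb
    have h1 := dist_triangle w (z b) x₀
    have h2 := dist_triangle_left (z b) x₀ w
    exact mem_iUnion₂.2 ⟨b, hb, by constructor <;> linarith⟩
  have h1 := (measure_mono hsub).trans (measure_biUnion_finset_le T
    (fun b => Icc (dist (z b) x₀ - r b) (dist (z b) x₀ + r b)) (μ := volume))
  simp only [Real.volume_Icc] at h1
  rw [← ENNReal.ofReal_sum_of_nonneg (fun b hb => by linarith [hr b hb]),
    ENNReal.ofReal_le_ofReal_iff (Finset.sum_nonneg fun b hb => by linarith [hr b hb])] at h1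
  refine (sub_zero L ▸ h1).trans (le_of_eq (Finset.sum_congr rfl fun b _ => by ring))

section

variable {Y : Type*} [MetricSpace Y] [MeasurableSpace Y] [BorelSpace Y]
variable {ν : Measure Y} {α p c C K τ r₁ : ℝ}

theorem PoincareData.tendsto_average (h : PoincareData ν α p c C K τ r₁) {u : Y → ℝ}
    (hu : Continuous u) (h0 : ∀ x, 0 ≤ u x) (h1 : ∀ x, u x ≤ 1) {z : Y} (hz : u z = 0)
    {r : ℕ → ℝ} (hr : ∀ i, 0 < r i) (hr0 : Tendsto r atTop (𝓝 0)) :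
    Tendsto (fun i => ⨍ y in Metric.ball z (r i), u y ∂ν) atTop (𝓝 0) := by
  have hnn : ∀ i, 0 ≤ ⨍ y in Metric.ball z (r i), u y ∂ν := by
    intro i
    rw [setAverage_eq, smul_eq_mul]
    exact mul_nonneg (by positivity) (integral_nonneg fun y => h0 y)
  refine Metric.tendsto_nhds.2 fun ε hε => ?_
  obtain ⟨δ, hδ, hball⟩ := Metric.continuous_iff.1 hu z (ε / 2) (by positivity)
  filter_upwards [hr0.eventually (gt_mem_nhds hδ)] with i hi
  rw [Real.dist_eq, sub_zero, abs_of_nonneg (hnn i), setAverage_eq, smul_eq_mul]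
  have hpos := h.measureReal_ball_pos z (hr i)
  have hle : ∫ y in Metric.ball z (r i), u y ∂ν ≤ ∫ _ in Metric.ball z (r i), ε / 2 ∂ν := by
    refine setIntegral_mono_on
      (integrableOn_ball_of_continuous_of_bounded hu h0 h1 (h.ball_lt_top _ _))
      (integrableOn_const (h.ball_lt_top _ _).ne) Metric.isOpen_ball.measurableSet fun y hy => ?_
    have := hball y ((Metric.mem_ball.1 hy).trans hi)
    rw [Real.dist_eq, hz, sub_zero, abs_of_nonneg (h0 y)] at this
    exact this.le
  rw [setIntegral_const, smul_eq_mul] at hle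
  calc _ ≤ (ν.real (Metric.ball z (r i)))⁻¹ * (ν.real (Metric.ball z (r i)) * (ε / 2)) := by gcongr
    _ = ε / 2 := by field_simp
    _ < ε := by linarith

/-- Comparison of the mean values over a ball and over the concentric ball of half the radius. -/
theorem PoincareData.average_sub_average_half_le (h : PoincareData ν α p c C K τ r₁) {u : Y → ℝ}
    {ρ : Y → ℝ≥0∞} (hu : Continuous u) (h0 : ∀ x, 0 ≤ u x) (h1 : ∀ x, u x ≤ 1)
    (hgrad : IsUpperGradient ρ u) {x : Y} {r I : ℝ} (hr : 0 < r) (hrr : r ≤ r₁) (hI : 0 ≤ I)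
    (hint : ∫⁻ y in Metric.ball x (τ * r), ρ y ^ p ∂ν ≤ ENNReal.ofReal I) :
    (⨍ y in Metric.ball x r, u y ∂ν) - ⨍ y in Metric.ball x (r / 2), u y ∂ν ≤
      C * 2 ^ α * K / c * (r ^ (p - α) * I) ^ (1 / p) := by
  have hP := h.poincare u ρ hu h0 h1 hgrad x r I hr hrr hI hint
  set m := ⨍ y in Metric.ball x r, u y ∂ν with hm
  set e := (r ^ (p - α) * I) ^ (1 / p) with he
  have he0 : 0 ≤ e := by positivity
  have hKpos := h.K_pos
  have hc := h.c_pos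
  have hCpos := h.C_pos
  have hsub : Metric.ball x (r / 2) ⊆ Metric.ball x r := Metric.ball_subset_ball (by linarith)
  have hB := integrableOn_ball_of_continuous_of_bounded (ν := ν) hu h0 h1 (h.ball_lt_top x r)
  have hdiff : IntegrableOn (fun y => |u y - m|) (Metric.ball x r) ν :=
    (hB.sub (integrableOn_const (h.ball_lt_top x r).ne)).abs
  have hconst : IntegrableOn (fun _ => m) (Metric.ball x (r / 2)) ν :=
    integrableOn_const (h.ball_lt_top x _).ne
  have hV := h.upper x r hr hrr
  have hV' := h.lower x (r / 2) (by positivity) (by linarith)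
  have hV'pos : 0 < ν.real (Metric.ball x (r / 2)) := h.measureReal_ball_pos x (by positivity)
  set V := ν.real (Metric.ball x r)
  set V' := ν.real (Metric.ball x (r / 2)) with hV'def
  have hkey : (m - ⨍ y in Metric.ball x (r / 2), u y ∂ν) * V' ≤ V * (K * e) := by
    calc (m - ⨍ y in Metric.ball x (r / 2), u y ∂ν) * V'
        = ∫ y in Metric.ball x (r / 2), (m - u y) ∂ν := by
          rw [integral_sub hconst (hB.mono_set hsub),
            setIntegral_const, smul_eq_mul, setAverage_eq, smul_eq_mul, ← hV'def]
          field_simp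
      _ ≤ ∫ y in Metric.ball x (r / 2), |u y - m| ∂ν := by
          refine integral_mono (hconst.sub (hB.mono_set hsub)) (hdiff.mono_set hsub) fun y => ?_
          rw [abs_sub_comm]
          exact le_abs_self _
      _ ≤ ∫ y in Metric.ball x r, |u y - m| ∂ν :=
          setIntegral_mono_set hdiff (Eventually.of_forall fun y => abs_nonneg _) hsub.eventuallyLE
      _ ≤ V * (K * e) := hP
  have hVV : V ≤ C * 2 ^ α / c * V' := by
    have : C * r ^ α = C * 2 ^ α / c * (c * (r / 2) ^ α) := by
      rw [Real.div_rpow hr.le zero_le_two]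
      field_simp
    rw [this] at hV
    exact hV.trans (by gcongr)
  rw [← mul_le_mul_iff_left₀ hV'pos]
  calc _ ≤ V * (K * e) := hkey
    _ ≤ (C * 2 ^ α / c * V') * (K * e) := by gcongr
    _ = _ := by ring

/-- If `u` vanishes at `z` while its mean value over `B(z, R)` is not small, then the energy of `u`
is large in some ball centred at `z`. -/
theorem PoincareData.exists_ball_energy (h : PoincareData ν α p c C K τ r₁) (hp : 1 ≤ p)
    (hαp : α - 1 < p) {R m₀ : ℝ} (hR : 0 < R) (hRr : R ≤ r₁) (hm₀ : 0 < m₀) :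
    ∃ a : ℝ, 0 < a ∧ ∀ (u : Y → ℝ) (ρ : Y → ℝ≥0∞), Continuous u → (∀ x, 0 ≤ u x) →
      (∀ x, u x ≤ 1) → IsUpperGradient ρ u → ∀ z, u z = 0 →
      ∫⁻ y in Metric.ball z (τ * R), ρ y ^ p ∂ν ≠ ∞ → m₀ < ⨍ y in Metric.ball z R, u y ∂ν →
      ∃ r, 0 < r ∧ r ≤ R ∧
        ENNReal.ofReal (a * r) ≤ ∫⁻ y in Metric.closedBall z (τ * r), ρ y ^ p ∂ν := by
  have hp0 : 0 < p := by linarith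
  have hKpos := h.K_pos
  have hc := h.c_pos
  have hCpos := h.C_pos
  have hτ := h.one_le_tau
  -- This exponent is positive because `α - 1 < p`. It is chosen so that a drop of order `q ^ i` at
  -- radius `r i` forces energy at least proportional to `r i`, the power suited to covering a
  -- one-dimensional set.
  set κ := (1 - α + p) / p with hκ
  have hκ0 : 0 < κ := div_pos (by linarith) hp0
  set q : ℝ := (1 / 2) ^ κ with hq
  have hq0 : 0 < q := by positivity
  have hq1 : q < 1 := Real.rpow_lt_one (by norm_num) (by norm_num) hκ0
  set D := C * 2 ^ α * K / c with hD
  have hDpos : 0 < D := by positivity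
  set b := m₀ * (1 - q) / D with hb
  have hbpos : 0 < b := div_pos (mul_pos hm₀ (by linarith)) hDpos
  refine ⟨b ^ p / R ^ (1 - α + p), by positivity, ?_⟩
  intro u ρ hu h0 h1 hgrad z hz hfin hlt
  set r : ℕ → ℝ := fun i => R * (1 / 2) ^ i with hrdef
  have hrpos : ∀ i, 0 < r i := fun i => by positivity
  have hrR : ∀ i, r i ≤ R := fun i =>
    mul_le_of_le_one_right hR.le (pow_le_one₀ (by norm_num) (by norm_num))
  have hr0 : Tendsto r atTop (𝓝 0) := by
    have := (tendsto_pow_atTop_nhds_zero_of_lt_one (r := (1 / 2 : ℝ)) (by norm_num)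
      (by norm_num)).const_mul R
    rwa [mul_zero] at this
  have ht := h.tendsto_average hu h0 h1 hz hrpos hr0
  obtain ⟨i, hi⟩ := exists_geometric_le_sub ht hm₀ (by simpa [hrdef] using hlt) hq0
  have hhalf : r (i + 1) = r i / 2 := by simp only [hrdef, pow_succ]; ring
  rw [hhalf] at hi
  have hfin' : ∫⁻ y in Metric.ball z (τ * r i), ρ y ^ p ∂ν ≠ ∞ :=
    ne_top_of_le_ne_top hfin (lintegral_mono_set
      (Metric.ball_subset_ball (mul_le_mul_of_nonneg_left (hrR i) (by linarith))))
  set I := (∫⁻ y in Metric.ball z (τ * r i), ρ y ^ p ∂ν).toReal with hI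
  have hI0 : 0 ≤ I := ENNReal.toReal_nonneg
  have hA := h.average_sub_average_half_le hu h0 h1 hgrad (hrpos i) ((hrR i).trans hRr) hI0
    (ENNReal.ofReal_toReal hfin').ge
  have h2 : b * q ^ i ≤ (r i ^ (p - α) * I) ^ (1 / p) := by
    have := hi.trans hA
    rw [hb, div_mul_eq_mul_div, div_le_iff₀ hDpos, mul_comm _ D]
    exact this
  have h3 := Real.rpow_le_rpow (by positivity) h2 hp0.le
  rw [← Real.rpow_mul (by positivity), one_div_mul_cancel hp0.ne', Real.rpow_one,
    Real.mul_rpow hbpos.le (by positivity)] at h3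
  have hqi : (q ^ i) ^ p = (r i / R) ^ (1 - α + p) := by
    have e1 : r i / R = (1 / 2) ^ i := by simp only [hrdef]; field_simp
    rw [e1, hq, ← Real.rpow_natCast, ← Real.rpow_natCast, ← Real.rpow_mul (by positivity),
      ← Real.rpow_mul (by positivity), ← Real.rpow_mul (by positivity)]
    congr 1
    rw [hκ]
    field_simp
  rw [hqi, Real.div_rpow (hrpos i).le hR.le] at h3
  have hrip : 0 < r i ^ (p - α) := Real.rpow_pos_of_pos (hrpos i) _
  have h4 : b ^ p / R ^ (1 - α + p) * r i ≤ I := by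
    have e2 : r i ^ (1 - α + p) = r i ^ (p - α) * r i := by
      rw [show 1 - α + p = (p - α) + 1 by ring, Real.rpow_add (hrpos i), Real.rpow_one]
    rw [e2] at h3
    rw [← mul_le_mul_iff_right₀ hrip]
    calc _ = b ^ p * (r i ^ (p - α) * r i / R ^ (1 - α + p)) := by ring
      _ ≤ _ := h3
  refine ⟨r i, hrpos i, hrR i, ?_⟩
  calc ENNReal.ofReal (b ^ p / R ^ (1 - α + p) * r i) ≤ ENNReal.ofReal I :=
        ENNReal.ofReal_le_ofReal h4
    _ = ∫⁻ y in Metric.ball z (τ * r i), ρ y ^ p ∂ν := ENNReal.ofReal_toReal hfin'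
    _ ≤ _ := lintegral_mono_set Metric.ball_subset_closedBall

/-- A function of small energy that vanishes on a compact set meeting all spheres
`S(x₀, t)`, `0 ≤ t ≤ R / 2`, has a small mean value over some ball of radius `R` centred on the
set. -/
theorem PoincareData.exists_average_le (h : PoincareData ν α p c C K τ r₁) (hp : 1 ≤ p)
    (hαp : α - 1 < p) {R m₀ : ℝ} (hR : 0 < R) (hRr : R ≤ r₁) (hm₀ : 0 < m₀) :
    ∃ I : ℝ, 0 < I ∧ ∀ (x₀ : Y) (F : Set Y), IsCompact F → F ⊆ Metric.closedBall x₀ (R / 2) →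
      (∀ t ∈ Icc 0 (R / 2), ∃ z ∈ F, dist z x₀ = t) →
      ∀ (u : Y → ℝ) (ρ : Y → ℝ≥0∞), Continuous u → (∀ x, 0 ≤ u x) →
      (∀ x, u x ≤ 1) → IsUpperGradient ρ u → (∀ z ∈ F, u z = 0) →
      ∫⁻ y in Metric.ball x₀ ((τ + 1) * R), ρ y ^ p ∂ν ≤ ENNReal.ofReal I →
      ∃ z ∈ F, ⨍ y in Metric.ball z R, u y ∂ν ≤ m₀ := by
  obtain ⟨a, ha, hball⟩ := h.exists_ball_energy hp hαp hR hRr hm₀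
  have hτ := h.one_le_tau
  have hτ0 : 0 < τ := by linarith
  -- Fivefold enlargement of balls of radii `τ * r` gives diameters of total `10 * τ * ∑ r`, at
  -- least `R / 2` by covering but at most `R / 4` by the energy bound.
  refine ⟨a * R / (40 * τ), by positivity, ?_⟩
  intro x₀ F hF hFsub hFt u ρ hu h0 h1 hgrad hFu hint
  by_contra! hcon
  have hsub : ∀ z ∈ F, ∀ r ≤ R,
      Metric.closedBall z (τ * r) ⊆ Metric.ball x₀ ((τ + 1) * R) := by
    intro z hz r hr
    refine Metric.closedBall_subset_ball' ?_
    have h2 : dist z x₀ ≤ R / 2 := hFsub hz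
    nlinarith
  have hr : ∀ z ∈ F, ∃ r, 0 < r ∧ r ≤ R ∧
      ENNReal.ofReal (a * r) ≤ ∫⁻ y in Metric.closedBall z (τ * r), ρ y ^ p ∂ν := by
    intro z hz
    refine hball u ρ hu h0 h1 hgrad z (hFu z hz) ?_ (hcon z hz)
    refine ne_top_of_le_ne_top ENNReal.ofReal_ne_top (le_trans (lintegral_mono_set ?_) hint)
    exact Metric.ball_subset_closedBall.trans (hsub z hz R le_rfl)
  choose! r hr0 hrR hra using hr
  obtain ⟨T, hTF, hTcov⟩ := hF.elim_nhds_subcover (fun z => Metric.closedBall z (τ * r z))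
    fun z hz => Metric.closedBall_mem_nhds z (mul_pos hτ0 (hr0 z hz))
  obtain ⟨u', hu'T, hdisj, hcov⟩ := Vitali.exists_disjoint_subfamily_covering_enlargement_closedBall
    (T : Set Y) (fun z => z) (fun z => τ * r z) (τ * R)
    (fun z hz => mul_le_mul_of_nonneg_left (hrR z (hTF z hz)) hτ0.le) 5 (by norm_num)
  have hu'fin : u'.Finite := T.finite_toSet.subset hu'T
  set W := hu'fin.toFinset with hW
  have hWF : ∀ b ∈ W, b ∈ F := fun b hb => hTF b (hu'T (hu'fin.mem_toFinset.1 hb))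
  have hcovF : F ⊆ ⋃ b ∈ W, Metric.closedBall b (5 * (τ * r b)) := by
    intro w hw
    obtain ⟨z, hzT, hwz⟩ := mem_iUnion₂.1 (hTcov hw)
    obtain ⟨b, hb, hsubb⟩ := hcov z hzT
    exact mem_iUnion₂.2 ⟨b, hu'fin.mem_toFinset.2 hb, hsubb hwz⟩
  have hlen := le_sum_of_dist_cover hFt W (fun b => b) (fun b => 5 * (τ * r b))
    (fun b hb => by have := hr0 b (hWF b hb); positivity) hcovF
  have henergy : ENNReal.ofReal (∑ b ∈ W, a * r b) ≤ ENNReal.ofReal (a * R / (40 * τ)) := by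
    rw [ENNReal.ofReal_sum_of_nonneg fun b hb => by have := hr0 b (hWF b hb); positivity]
    calc ∑ b ∈ W, ENNReal.ofReal (a * r b)
        ≤ ∑ b ∈ W, ∫⁻ y in Metric.closedBall b (τ * r b), ρ y ^ p ∂ν :=
          Finset.sum_le_sum fun b hb => hra b (hWF b hb)
      _ = ∫⁻ y in ⋃ b ∈ W, Metric.closedBall b (τ * r b), ρ y ^ p ∂ν := by
          rw [lintegral_biUnion_finset _ fun b _ => Metric.isClosed_closedBall.measurableSet]
          rw [hW, hu'fin.coe_toFinset]
          exact hdisj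
      _ ≤ ∫⁻ y in Metric.ball x₀ ((τ + 1) * R), ρ y ^ p ∂ν :=
          lintegral_mono_set (iUnion₂_subset fun b hb => hsub b (hWF b hb) _ (hrR b (hWF b hb)))
      _ ≤ _ := hint
  rw [ENNReal.ofReal_le_ofReal_iff (by positivity), ← Finset.mul_sum, mul_div_assoc,
    mul_le_mul_iff_right₀ ha, le_div_iff₀ (by positivity)] at henergy
  have hsum : ∑ b ∈ W, 2 * (5 * (τ * r b)) = 10 * τ * ∑ b ∈ W, r b := by
    rw [Finset.mul_sum]
    exact Finset.sum_congr rfl fun b _ => by ring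
  rw [hsum] at hlen
  linarith

end

/-! ### Uniform lower bounds for the modulus of paths joining continua to balls -/

/-- Near `x`, for every `ρ` of small energy and every `C ∈ 𝒞`, the set of points joined to `C` by
paths of bounded `ρ`-length has measure bounded below. -/
def UniformlyReached {Y : Type*} [MetricSpace Y] [MeasurableSpace Y] (ν : Measure Y) (p : ℝ)
    (𝒞 : Set (Set Y)) (x : Y) : Prop :=
  ∀ s : ℝ, 0 < s → ∃ c : ℝ, 0 < c ∧ ∃ θ : ℝ, 0 < θ ∧ ∃ N : ℕ, ∀ ρ : Y → ℝ≥0∞, Measurable ρ →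
    ∫⁻ y, ρ y ^ p ∂ν ≤ ENNReal.ofReal c → ∀ C ∈ 𝒞, ∃ G : Set Y, IsClosed G ∧
      G ⊆ Metric.closedBall x s ∧ θ ≤ ν.real G ∧ ∀ z ∈ G, Reached ρ C N z

/-- The compact sets that meet all spheres `S(x₀, t)`, `0 ≤ t ≤ ε`. -/
def compactsCrossing {Y : Type*} [MetricSpace Y] (x₀ : Y) (ε : ℝ) : Set (Set Y) :=
  {C | IsCompact C ∧ ∀ t ∈ Icc 0 ε, ∃ z ∈ C, dist z x₀ = t}

section

variable {Y : Type*} [MetricSpace Y] [MeasurableSpace Y] [BorelSpace Y]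
variable {ν : Measure Y} {α p c C K τ r₁ : ℝ}

theorem exists_isCompact_closedBall_radius {Y : Type*} [MetricSpace Y] [LocallyCompactSpace Y]
    (x : Y) : ∃ R : ℝ, 0 < R ∧ IsCompact (Metric.closedBall x R) := by
  obtain ⟨K, hK, hx⟩ := exists_compact_mem_nhds x
  obtain ⟨R, hR, hRK⟩ := Metric.nhds_basis_closedBall.mem_iff.1 hx
  exact ⟨R, hR, hK.of_isClosed_subset Metric.isClosed_closedBall hRK⟩

/-- Some ball of radius `R` centred on the crossing set has small mean value and contains `B(x₀, R /
2)`. Markov's inequality leaves at most half of the latter unreached. -/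
theorem PoincareData.uniformlyReached_base (h : PoincareData ν α p c C K τ r₁) (hp : 1 ≤ p)
    (hαp : α - 1 < p) [LocallyCompactSpace Y] (x₀ : Y) {ε : ℝ} (hε : 0 < ε) :
    UniformlyReached ν p (compactsCrossing x₀ ε) x₀ := by
  intro s hs
  have hτ := h.one_le_tau
  have hCpos := h.C_pos
  obtain ⟨R', hR', hK⟩ := exists_isCompact_closedBall_radius x₀
  obtain ⟨R, hR, hRs, hRε, hRr, hRR'⟩ : ∃ R, 0 < R ∧ R ≤ s ∧ R ≤ ε ∧ R ≤ r₁ ∧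
      (τ + 1) * R < R' := by
    refine ⟨min (min s ε) (min r₁ (R' / (2 * (τ + 1)))), ?_, ?_, ?_, ?_, ?_⟩
    · have := h.r₁_pos
      positivity
    · exact (min_le_left _ _).trans (min_le_left _ _)
    · exact (min_le_left _ _).trans (min_le_right _ _)
    · exact (min_le_right _ _).trans (min_le_left _ _)
    · have h1 : min (min s ε) (min r₁ (R' / (2 * (τ + 1)))) ≤ R' / (2 * (τ + 1)) :=
        (min_le_right _ _).trans (min_le_right _ _)
      rw [le_div_iff₀ (by positivity)] at h1
      linarith
  set B := Metric.ball x₀ (R / 2) with hB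
  set V := ν.real B with hV
  have hVpos : 0 < V := h.measureReal_ball_pos x₀ (by positivity)
  -- Chosen so that Markov's bound `2 * m₀ * (C * R ^ α)` equals `V / 2`.
  set m₀ := V / (4 * (C * R ^ α)) with hm₀
  have hm₀pos : 0 < m₀ := by positivity
  obtain ⟨I, hI, hIu⟩ := h.exists_average_le hp hαp hR hRr hm₀pos
  refine ⟨I / 3, by positivity, V / 2, by positivity, 2, ?_⟩
  rintro ρ hρ hρI S ⟨hSc, hS⟩
  set F := S ∩ Metric.closedBall x₀ (R / 2) with hF
  have hFc : IsCompact F := hSc.inter_right Metric.isClosed_closedBall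
  have hFt : ∀ t ∈ Icc 0 (R / 2), ∃ z ∈ F, dist z x₀ = t := by
    intro t ht
    obtain ⟨z, hz, rfl⟩ := hS t ⟨ht.1, ht.2.trans (by linarith)⟩
    exact ⟨z, ⟨hz, ht.2⟩, rfl⟩
  have hball : Metric.closedBall x₀ (R / 2) ⊆ Metric.closedBall x₀ ((τ + 1) * R) :=
    Metric.closedBall_subset_closedBall (by nlinarith)
  have hBfin : ν B ≠ ∞ := (h.ball_lt_top _ _).ne
  obtain ⟨G, hGc, hGB, hGr⟩ := exists_reached_of_energy (ν := ν) hp hRR' hK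
    (h.ball_lt_top _ _).ne hI (F := F) (B := B) (t := ENNReal.ofReal (V / 2))
    hFc.isClosed (inter_subset_right.trans hball) (Metric.ball_subset_closedBall.trans hball)
    (fun u ρ' hu h0 h1 hFu hgrad hint => by
      obtain ⟨z, hz, hav⟩ := hIu x₀ F hFc inter_subset_right hFt u ρ' hu h0 h1 hgrad hFu hint
      have hsub : {y ∈ B | 1 / 2 ≤ u y} ⊆ {y ∈ Metric.ball z R | 1 / 2 ≤ u y} := by
        rintro y ⟨hy, hy'⟩
        refine ⟨?_, hy'⟩
        have h2 : dist y x₀ < R / 2 := hy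
        have h3 : dist z x₀ ≤ R / 2 := hz.2
        rw [Metric.mem_ball]
        linarith [dist_triangle_right y z x₀]
      have hle := h.measureReal_le_average hu h0 h1 (x := z) hR
      have hup := h.upper z R hR hRr
      have hfin : ν {y ∈ Metric.ball z R | 1 / 2 ≤ u y} ≠ ∞ :=
        ne_top_of_le_ne_top (h.ball_lt_top z R).ne (measure_mono fun y hy => hy.1)
      refine (measure_mono hsub).trans ?_
      rw [← ofReal_measureReal hfin]
      refine ENNReal.ofReal_le_ofReal (hle.trans ?_)
      calc 2 * (⨍ y in Metric.ball z R, u y ∂ν) * ν.real (Metric.ball z R)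
          ≤ 2 * m₀ * (C * R ^ α) := by gcongr
        _ = V / 2 := by rw [hm₀]; field_simp; norm_num)
    hρ hρI
  refine ⟨G ∩ Metric.closedBall x₀ (R / 2), hGc.inter Metric.isClosed_closedBall,
    inter_subset_right.trans (Metric.closedBall_subset_closedBall (by linarith)), ?_, ?_⟩
  · have hGfin : ν (G ∩ Metric.closedBall x₀ (R / 2)) ≠ ∞ := by
      refine ne_top_of_le_ne_top (h.ball_lt_top x₀ R).ne (measure_mono ?_)
      exact inter_subset_right.trans (Metric.closedBall_subset_ball (by linarith))
    have hdiff : ν.real (B \ G) ≤ V / 2 :=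
      ENNReal.toReal_le_of_le_ofReal (by positivity) hGB
    have hcov : V ≤ ν.real (G ∩ Metric.closedBall x₀ (R / 2)) + ν.real (B \ G) := by
      refine (measureReal_mono (fun y hy => ?_) ?_).trans (measureReal_union_le _ _)
      · by_cases hyG : y ∈ G
        · exact Or.inl ⟨hyG, Metric.ball_subset_closedBall hy⟩
        · exact Or.inr ⟨hy, hyG⟩
      · exact measure_union_ne_top hGfin
          (ne_top_of_le_ne_top hBfin (measure_mono sdiff_subset))
    linarith
  · intro z hz
    exact (hGr z hz.1).mono (fun _ => le_rfl) inter_subset_left (by norm_num)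

/-- The set reached near `x` serves as the new zero set: its measure is at least a `θ` independent
of `ρ` and of the continuum, so for small energy at least half of any prescribed small ball at `x'`
is joined to it. Concatenating paths adds `2` to the integral. -/
theorem PoincareData.uniformlyReached_step (h : PoincareData ν α p c C K τ r₁) (hp : 1 ≤ p)
    {𝒞 : Set (Set Y)} {y : Y} {R R' : ℝ} (hR : 0 < R) (hRr : R ≤ r₁) (hRR' : τ * R < R')
    (hK : IsCompact (Metric.closedBall y R')) {x x' : Y} (hx : x ∈ Metric.ball y (R / 2))
    (hx' : x' ∈ Metric.ball y (R / 2)) (hgood : UniformlyReached ν p 𝒞 x) :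
    UniformlyReached ν p 𝒞 x' := by
  intro s' hs'
  have hτ := h.one_le_tau
  obtain ⟨c₁, hc₁, θ, hθ, N, hN⟩ := hgood (R / 4) (by positivity)
  set s := min s' (R / 4) with hs
  have hspos : 0 < s := by positivity
  have hsR : s ≤ R / 4 := min_le_right _ _
  set B := Metric.ball y R with hB
  set B' := Metric.ball x' s with hB'
  set V := ν.real B with hV
  set V' := ν.real B' with hV'
  have hVpos : 0 < V := h.measureReal_ball_pos y hR
  have hV'pos : 0 < V' := h.measureReal_ball_pos x' hspos
  have hB'B : B' ⊆ B := by
    refine Metric.ball_subset_ball' ?_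
    rw [Metric.mem_ball] at hx'
    linarith
  have hxB : Metric.closedBall x (R / 4) ⊆ B := by
    refine Metric.closedBall_subset_ball' ?_
    rw [Metric.mem_ball] at hx
    linarith
  obtain ⟨I, hI, hIε⟩ := h.exists_energy hp hR (ε := V' / 2 / (2 * V ^ 2 / θ)) (by positivity)
  have hRτ : R ≤ τ * R := by nlinarith
  have hBτ : B ⊆ Metric.closedBall y (τ * R) :=
    Metric.ball_subset_closedBall.trans (Metric.closedBall_subset_closedBall hRτ)
  refine ⟨min c₁ (I / 3), by positivity, V' / 2, by positivity, N + 2, ?_⟩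
  intro ρ hρ hρI S hS
  obtain ⟨G, hGc, hGx, hGθ, hGr⟩ := hN ρ hρ
    (hρI.trans (ENNReal.ofReal_le_ofReal (min_le_left _ _))) S hS
  obtain ⟨G', hG'c, hG'B, hG'r⟩ := exists_reached_of_energy (ν := ν) hp hRR' hK
    (h.ball_lt_top _ _).ne hI (F := G) (B := B) (t := ENNReal.ofReal (V' / 2))
    hGc ((hGx.trans hxB).trans hBτ) hBτ
    (fun u ρ' hu h0 h1 hGu hgrad hint => by
      have hle := h.measureReal_le_of_vanishing hu h0 h1 hgrad hGc hGu hR hRr hI.le hint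
        (hGx.trans hxB) hθ hGθ
      have hfin : ν {z ∈ B | 1 / 2 ≤ u z} ≠ ∞ :=
        ne_top_of_le_ne_top (h.ball_lt_top y R).ne (measure_mono fun y hy => hy.1)
      rw [← ofReal_measureReal hfin]
      refine ENNReal.ofReal_le_ofReal (hle.trans ?_)
      calc 2 * V ^ 2 / θ * (K * (R ^ (p - α) * I) ^ (1 / p))
          ≤ 2 * V ^ 2 / θ * (V' / 2 / (2 * V ^ 2 / θ)) := by gcongr
        _ = V' / 2 := by field_simp)
    hρ (hρI.trans (ENNReal.ofReal_le_ofReal (min_le_right _ _)))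
  refine ⟨G' ∩ Metric.closedBall x' s, hG'c.inter Metric.isClosed_closedBall,
    inter_subset_right.trans (Metric.closedBall_subset_closedBall (min_le_left _ _)), ?_, ?_⟩
  · have hGfin : ν (G' ∩ Metric.closedBall x' s) ≠ ∞ := by
      refine ne_top_of_le_ne_top (h.ball_lt_top x' (2 * s)).ne (measure_mono ?_)
      exact inter_subset_right.trans (Metric.closedBall_subset_ball (by linarith))
    have hdiff : ν.real (B \ G') ≤ V' / 2 :=
      ENNReal.toReal_le_of_le_ofReal (by positivity) hG'B
    have hcov : V' ≤ ν.real (G' ∩ Metric.closedBall x' s) + ν.real (B \ G') := by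
      refine (measureReal_mono (fun z hz => ?_) ?_).trans (measureReal_union_le _ _)
      · by_cases hzG : z ∈ G'
        · exact Or.inl ⟨hzG, Metric.ball_subset_closedBall hz⟩
        · exact Or.inr ⟨hB'B hz, hzG⟩
      · exact measure_union_ne_top hGfin
          (ne_top_of_le_ne_top (h.ball_lt_top y R).ne (measure_mono sdiff_subset))
    linarith
  · intro z hz
    have := Reached.trans hGr (hG'r z hz.1)
    exact this.mono (fun _ => le_rfl) Subset.rfl (by push_cast; exact le_rfl)

/-- Propagation of the property between nearby points is a transitive relation valid in both
directions locally, so connectedness spreads it everywhere. -/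
theorem PoincareData.uniformlyReached (h : PoincareData ν α p c C K τ r₁) (hp : 1 ≤ p)
    (hαp : α - 1 < p) [LocallyCompactSpace Y] [PreconnectedSpace Y] (x₀ : Y) {ε : ℝ} (hε : 0 < ε)
    (x : Y) : UniformlyReached ν p (compactsCrossing x₀ ε) x := by
  refine PreconnectedSpace.induction₂' (fun a b => UniformlyReached ν p (compactsCrossing x₀ ε) a →
    UniformlyReached ν p (compactsCrossing x₀ ε) b) (fun y => ?_) ⟨fun a b c hab hbc ha =>
      hbc (hab ha)⟩ x₀ x (h.uniformlyReached_base hp hαp x₀ hε)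
  have hτ := h.one_le_tau
  obtain ⟨R', hR', hK⟩ := exists_isCompact_closedBall_radius y
  set R := min r₁ (R' / (2 * τ)) with hR
  have hRpos : 0 < R := by have := h.r₁_pos; positivity
  have hRR' : τ * R < R' := by
    have h1 : R ≤ R' / (2 * τ) := min_le_right _ _
    rw [le_div_iff₀ (by positivity)] at h1
    linarith
  have hy : y ∈ Metric.ball y (R / 2) := Metric.mem_ball_self (by positivity)
  filter_upwards [Metric.ball_mem_nhds y (by positivity : 0 < R / 2)] with z hz
  exact ⟨h.uniformlyReached_step hp hRpos (min_le_left _ _) hRR' hK hy hz,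
    h.uniformlyReached_step hp hRpos (min_le_left _ _) hRR' hK hz hy⟩

/-- If `ρ` has small energy, then every compact set that meets the spheres `S(x₀, t)`,
`0 ≤ t ≤ ε`, is joined to a given ball by a path along which the integral of `ρ` is less than
`1`. -/
theorem PoincareData.exists_path_to_closedBall (h : PoincareData ν α p c C K τ r₁) (hp : 1 ≤ p)
    (hαp : α - 1 < p) [LocallyCompactSpace Y] [PreconnectedSpace Y] (x₀ : Y) {ε : ℝ} (hε : 0 < ε)
    (x : Y) {s : ℝ} (hs : 0 < s) :
    ∃ e : ℝ, 0 < e ∧ ∀ ρ : Y → ℝ≥0∞, Measurable ρ → ∫⁻ y, ρ y ^ p ∂ν ≤ ENNReal.ofReal e →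
      ∀ S ∈ compactsCrossing x₀ ε, ∃ (ℓ : ℝ) (φ : ℝ → Y), 0 ≤ ℓ ∧ LipschitzWith 1 φ ∧ φ 0 ∈ S ∧
        φ ℓ ∈ Metric.closedBall x s ∧ ∫⁻ t in Icc 0 ℓ, ρ (φ t) < 1 := by
  obtain ⟨e, he, θ, hθ, N, hN⟩ := h.uniformlyReached hp hαp x₀ hε x s hs
  have hp0 : 0 < p := by linarith
  -- Reachability with bound `N` is applied to `M * ρ`; dividing by `M` leaves at most `N / (N + 1)
  -- < 1`, at the price of a factor `M ^ p` in the energy.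
  set M : ℝ := N + 1 with hM
  have hMpos : 0 < M := by positivity
  refine ⟨e / M ^ p, by positivity, fun ρ hρ hρe S hS => ?_⟩
  obtain ⟨G, -, hGx, hGθ, hG⟩ := hN (fun y => ENNReal.ofReal M * ρ y) (hρ.const_mul _) (by
    calc ∫⁻ y, (ENNReal.ofReal M * ρ y) ^ p ∂ν = ENNReal.ofReal (M ^ p) * ∫⁻ y, ρ y ^ p ∂ν := by
          simp only [ENNReal.mul_rpow_of_nonneg _ _ hp0.le]
          rw [lintegral_const_mul _ (hρ.pow_const p),
            ENNReal.ofReal_rpow_of_nonneg hMpos.le hp0.le]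
      _ ≤ ENNReal.ofReal (M ^ p) * ENNReal.ofReal (e / M ^ p) := by gcongr
      _ = ENNReal.ofReal e := by
          rw [← ENNReal.ofReal_mul (by positivity), mul_div_cancel₀ _ (by positivity)]) S hS
  obtain ⟨z, hz⟩ : G.Nonempty := by
    by_contra hne
    rw [not_nonempty_iff_eq_empty.1 hne, measureReal_empty] at hGθ
    linarith
  obtain ⟨ℓ, φ, hℓ, hlip, h0, hend, hint⟩ := hG z hz
  refine ⟨ℓ, φ, hℓ, hlip, h0, hend ▸ hGx hz, ?_⟩
  beta_reduce at hint
  rw [lintegral_const_mul (f := fun t => ρ (φ t)) _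
    (hρ.comp hlip.continuous.measurable)] at hint
  by_contra hcon
  have h1 : ENNReal.ofReal M * 1 ≤ N := (by gcongr; exact not_lt.1 hcon : _ ≤ _).trans hint
  rw [mul_one, ← ENNReal.ofReal_natCast, ENNReal.ofReal_le_ofReal_iff (Nat.cast_nonneg N)] at h1
  linarith

end

/-! ### Weights of finite mean oscillation -/

section Growth

variable {Z : Type*} [MetricSpace Z] [MeasurableSpace Z]

/-- A discrete form of integrating `k ^ (s - 1)`, by way of `k ^ s + k ^ (s - 1) ≤ (k + 1) ^ s`. -/
theorem le_mul_rpow_of_recurrence {m : ℕ → ℝ} {s B : ℝ} (hs : 1 ≤ s) (hB : 0 ≤ B) {k₀ : ℕ}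
    (hk₀ : 1 ≤ k₀) (hm : ∀ k ≥ k₀, m (k + 1) ≤ m k + B * (k : ℝ) ^ (s - 1)) :
    ∀ k ≥ k₀, m k ≤ max B (m k₀) * (k : ℝ) ^ s := by
  intro k hk
  set A := max B (m k₀) with hA
  have hA0 : 0 ≤ A := hB.trans (le_max_left _ _)
  induction k, hk using Nat.le_induction with
  | base =>
    have h1 : (1 : ℝ) ≤ (k₀ : ℝ) ^ s :=
      Real.one_le_rpow (by exact_mod_cast hk₀) (by linarith)
    calc m k₀ ≤ A := le_max_right _ _
      _ ≤ A * (k₀ : ℝ) ^ s := le_mul_of_one_le_right hA0 h1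
  | succ k hk ih =>
    have hkpos : (0 : ℝ) < k := by exact_mod_cast (by omega : 0 < k)
    have h1 : (k : ℝ) ^ s + (k : ℝ) ^ (s - 1) ≤ ((k : ℝ) + 1) ^ s := by
      have e1 : (k : ℝ) ^ s = k * (k : ℝ) ^ (s - 1) := by
        rw [Real.rpow_sub_one hkpos.ne']; field_simp
      have e2 : ((k : ℝ) + 1) ^ s = (k + 1) * ((k : ℝ) + 1) ^ (s - 1) := by
        rw [Real.rpow_sub_one (by positivity)]; field_simp
      have e3 : (k : ℝ) ^ (s - 1) ≤ ((k : ℝ) + 1) ^ (s - 1) :=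
        Real.rpow_le_rpow hkpos.le (by linarith) (by linarith)
      rw [e1, e2]
      nlinarith
    have h2 : B * (k : ℝ) ^ (s - 1) ≤ A * (k : ℝ) ^ (s - 1) := by
      gcongr
      exact le_max_left _ _
    push_cast
    calc m (k + 1) ≤ m k + B * (k : ℝ) ^ (s - 1) := hm k hk
      _ ≤ A * ((k : ℝ) ^ s + (k : ℝ) ^ (s - 1)) := by linarith
      _ ≤ A * ((k : ℝ) + 1) ^ s := by gcongr

/-- The integrals of a weight of finite mean oscillation over the balls of radius `2 ^ (-k)`. -/
theorem FMOAt.exists_lintegral_ball_le {ν : Measure Z} {a : ℝ} (ha : 2 ≤ a) {y₀ : Z}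
    {Q : Z → ℝ≥0∞} (hQ : AEMeasurable Q ν) (hfmo : FMOAt ν Q y₀)
    (hreg : UpperRegular ν a)
    (hdoub : ∃ γ : ℝ, 0 < γ ∧ ∃ r₀ : ℝ, 0 < r₀ ∧ ∀ r : ℝ, 0 < r → r < r₀ →
      ν (Metric.ball y₀ (2 * r)) ≤
        ENNReal.ofReal (γ * Real.log (1 / r) ^ (a - 2)) * ν (Metric.ball y₀ r)) :
    ∃ A : ℝ, 0 < A ∧ ∃ k₀ : ℕ, 1 ≤ k₀ ∧ ∀ k ≥ k₀,
      ∫⁻ y in Metric.ball y₀ ((1 / 2) ^ k), Q y ∂ν ≤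
        ENNReal.ofReal (A * ((1 / 2 : ℝ) ^ k) ^ a * (k : ℝ) ^ (a - 1)) := by
  obtain ⟨⟨rI, hrI, hint⟩, hlim⟩ := hfmo
  obtain ⟨C, hC, rU, hrU, hup⟩ := hreg y₀
  obtain ⟨γ, hγ, rD, hrD, hdoub⟩ := hdoub
  obtain ⟨M', hM'1, hM'2⟩ := exists_between hlim
  have hMev := eventually_lt_of_limsup_lt hM'1
  set M := M'.toReal with hM
  have hM0 : 0 ≤ M := ENNReal.toReal_nonneg
  set r : ℕ → ℝ := fun k => (1 / 2) ^ k with hr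
  have hrpos : ∀ k, 0 < r k := fun k => by positivity
  have hr0 : Tendsto r atTop (𝓝[>] 0) := by
    refine tendsto_nhdsWithin_iff.2 ⟨tendsto_pow_atTop_nhds_zero_of_lt_one (by norm_num)
      (by norm_num), Eventually.of_forall hrpos⟩
  have hsm : ∀ᶠ k in atTop, r k < min rI (min rU rD) :=
    (tendsto_nhdsWithin_iff.1 hr0).1.eventually (gt_mem_nhds (by positivity))
  obtain ⟨k₁, hk₁⟩ := eventually_atTop.1 ((hr0.eventually hMev).and hsm)
  set k₀ := max k₁ 1 with hk₀
  have hk₀1 : 1 ≤ k₀ := le_max_right _ _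
  set B : ℕ → Set Z := fun k => Metric.ball y₀ (r k) with hB
  set g : Z → ℝ := fun y => (Q y).toReal with hg
  set m : ℕ → ℝ := fun k => ⨍ y in B k, g y ∂ν with hm
  have hgm : AEStronglyMeasurable g ν := hQ.ennreal_toReal.aestronglyMeasurable
  have hg0 : ∀ y, 0 ≤ g y := fun y => ENNReal.toReal_nonneg
  have hm0 : ∀ k, 0 ≤ m k := by
    intro k
    simp only [hm]
    rw [setAverage_eq, smul_eq_mul]
    exact mul_nonneg (by positivity) (integral_nonneg hg0)
  have hsmall : ∀ k ≥ k₀, r k < rI ∧ r k < rU ∧ r k < rD := by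
    intro k hk
    have := (hk₁ k ((le_max_left _ _).trans hk)).2
    exact ⟨this.trans_le (min_le_left _ _),
      this.trans_le ((min_le_right _ _).trans (min_le_left _ _)),
      this.trans_le ((min_le_right _ _).trans (min_le_right _ _))⟩
  have hupk : ∀ k ≥ k₀, ν (B k) ≤ ENNReal.ofReal (C * r k ^ a) := fun k hk =>
    hup (r k) (hrpos k) (hsmall k hk).2.1
  have hfin : ∀ k ≥ k₀, ν (B k) ≠ ∞ := fun k hk =>
    ne_top_of_le_ne_top ENNReal.ofReal_ne_top (hupk k hk)
  have hQfin : ∀ k ≥ k₀, ∫⁻ y in B k, Q y ∂ν ≠ ∞ := fun k hk =>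
    ne_top_of_le_ne_top hint.ne
      (lintegral_mono_set (Metric.ball_subset_ball (hsmall k hk).1.le))
  have hgi : ∀ k ≥ k₀, IntegrableOn g (B k) ν := fun k hk =>
    integrable_toReal_of_lintegral_ne_top hQ.restrict (hQfin k hk)
  have hosc : ∀ k ≥ k₀, ∫ y in B k, |g y - m k| ∂ν ≤ M * ν.real (B k) := by
    intro k hk
    have h1 := (hk₁ k ((le_max_left _ _).trans hk)).1.le
    rw [setLAverage_eq, ENNReal.div_le_iff_le_mul (Or.inr hM'2.ne) (Or.inl (hfin k hk))] at h1
    rw [integral_eq_lintegral_of_nonneg_ae (f := fun y => |g y - m k|)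
      (Eventually.of_forall fun y => abs_nonneg _)
      (hgm.sub aestronglyMeasurable_const).restrict.norm]
    have h2 := ENNReal.toReal_mono (ENNReal.mul_ne_top hM'2.ne (hfin k hk)) h1
    rwa [ENNReal.toReal_mul] at h2
  -- Consecutive means differ by at most the oscillation times the ratio of the measures, and the
  -- logarithmic doubling condition bounds that ratio by a multiple of `k ^ (a - 2)`. Summation
  -- yields means of order `k ^ (a - 1)`.
  have hrec : ∀ k ≥ k₀, m (k + 1) ≤ m k + M * γ * 2 ^ (a - 2) * (k : ℝ) ^ ((a - 1) - 1) := by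
    intro k hk
    have hk1 : k₀ ≤ k + 1 := by omega
    have hkpos : (0 : ℝ) < k := by exact_mod_cast (by omega : 0 < k)
    have hsub : B (k + 1) ⊆ B k := by
      refine Metric.ball_subset_ball ?_
      simp only [hr, pow_succ]
      linarith [hrpos k]
    -- On a null ball the mean is `0` by convention, so the recurrence is trivial.
    by_cases hV : ν.real (B (k + 1)) = 0
    · have : m (k + 1) = 0 := by
        simp only [hm]
        rw [setAverage_eq, hV, inv_zero, zero_smul]
      rw [this]
      have := hm0 k
      positivity
    have hVpos : 0 < ν.real (B (k + 1)) := lt_of_le_of_ne measureReal_nonneg (Ne.symm hV)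
    have hd : ν.real (B k) ≤ γ * 2 ^ (a - 2) * (k : ℝ) ^ (a - 2) * ν.real (B (k + 1)) := by
      have h1 := hdoub (r (k + 1)) (hrpos _) (hsmall _ hk1).2.2
      have e1 : 2 * r (k + 1) = r k := by simp only [hr, pow_succ]; ring
      rw [e1] at h1
      have hlog0 : 0 ≤ Real.log (1 / r (k + 1)) := by
        apply Real.log_nonneg
        rw [le_div_iff₀ (hrpos _), one_mul]
        exact pow_le_one₀ (by norm_num) (by norm_num)
      have hlog : Real.log (1 / r (k + 1)) ≤ 2 * k := by
        simp only [hr, one_div, inv_pow, inv_inv]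
        rw [Real.log_pow]
        push_cast
        have h2 : Real.log 2 ≤ 1 := by linarith [Real.log_two_lt_d9]
        have h3 : (1 : ℝ) ≤ k := by exact_mod_cast (by omega : 1 ≤ k)
        have h4 : 0 ≤ Real.log 2 := Real.log_nonneg (by norm_num)
        nlinarith
      have h3 := ENNReal.toReal_mono (ENNReal.mul_ne_top ENNReal.ofReal_ne_top (hfin _ hk1)) h1
      rw [ENNReal.toReal_mul, ENNReal.toReal_ofReal (by positivity)] at h3
      have e2 : γ * 2 ^ (a - 2) * (k : ℝ) ^ (a - 2) = γ * (2 * (k : ℝ)) ^ (a - 2) := by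
        rw [Real.mul_rpow zero_le_two hkpos.le]; ring
      rw [e2]
      refine h3.trans ?_
      change _ * ν.real (B (k + 1)) ≤ _
      gcongr
    have hconst : IntegrableOn (fun _ => m k) (B (k + 1)) ν := integrableOn_const (hfin _ hk1)
    have hconst' : IntegrableOn (fun _ => m k) (B k) ν := integrableOn_const (hfin _ hk)
    have hdiff : IntegrableOn (fun y => |g y - m k|) (B k) ν := ((hgi k hk).sub hconst').abs
    have hmain : (m (k + 1) - m k) * ν.real (B (k + 1)) ≤
        M * (γ * 2 ^ (a - 2) * (k : ℝ) ^ (a - 2) * ν.real (B (k + 1))) := by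
      calc (m (k + 1) - m k) * ν.real (B (k + 1))
          = ∫ y in B (k + 1), (g y - m k) ∂ν := by
            rw [integral_sub (hgi _ hk1) hconst, setIntegral_const, smul_eq_mul]
            have : ∫ y in B (k + 1), g y ∂ν = m (k + 1) * ν.real (B (k + 1)) := by
              simp only [hm]
              rw [setAverage_eq, smul_eq_mul]
              field_simp
            rw [this]
            ring
        _ ≤ ∫ y in B (k + 1), |g y - m k| ∂ν :=
            integral_mono ((hgi _ hk1).sub hconst) (hdiff.mono_set hsub) fun y => le_abs_self _
        _ ≤ ∫ y in B k, |g y - m k| ∂ν :=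
            setIntegral_mono_set hdiff (Eventually.of_forall fun y => abs_nonneg _)
              hsub.eventuallyLE
        _ ≤ M * ν.real (B k) := hosc k hk
        _ ≤ _ := by gcongr
    rw [show a - 1 - 1 = a - 2 by ring]
    have : m (k + 1) - m k ≤ M * (γ * 2 ^ (a - 2) * (k : ℝ) ^ (a - 2)) := by
      rw [← mul_le_mul_iff_left₀ hVpos]
      linarith
    linarith
  have hmk := le_mul_rpow_of_recurrence (by linarith : 1 ≤ a - 1)
    (by positivity : 0 ≤ M * γ * 2 ^ (a - 2)) hk₀1 hrec
  set A' := max (M * γ * 2 ^ (a - 2)) (m k₀) with hA'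
  have hA'0 : 0 ≤ A' := le_max_of_le_right (hm0 k₀)
  refine ⟨(A' + 1) * C, by positivity, k₀, hk₀1, fun k hk => ?_⟩
  have hint' : ∫ y in B k, g y ∂ν = (∫⁻ y in B k, Q y ∂ν).toReal :=
    integral_toReal hQ.restrict (ae_lt_top' hQ.restrict (hQfin k hk))
  have hVle : ν.real (B k) ≤ C * r k ^ a :=
    ENNReal.toReal_le_of_le_ofReal (by have := hrpos k; positivity) (hupk k hk)
  have hJ : ∫ y in B k, g y ∂ν ≤ m k * ν.real (B k) := by
    by_cases hV : ν.real (B k) = 0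
    · have h0 : ν (B k) = 0 := by
        rwa [Measure.real, ENNReal.toReal_eq_zero_iff, or_iff_left (hfin k hk)] at hV
      rw [setIntegral_measure_zero _ h0, hV, mul_zero]
    · simp only [hm]
      rw [setAverage_eq, smul_eq_mul]
      field_simp
      exact le_rfl
  rw [← ENNReal.ofReal_toReal (hQfin k hk), ← hint']
  apply ENNReal.ofReal_le_ofReal
  have hrp := hrpos k
  calc ∫ y in B k, g y ∂ν ≤ m k * ν.real (B k) := hJ
    _ ≤ (A' * (k : ℝ) ^ (a - 1)) * (C * r k ^ a) := by
        gcongr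
        exact hmk k hk
    _ ≤ ((A' + 1) * (k : ℝ) ^ (a - 1)) * (C * r k ^ a) := by gcongr; linarith
    _ = (A' + 1) * C * ((1 / 2 : ℝ) ^ k) ^ a * (k : ℝ) ^ (a - 1) := by ring

/-! ### Dyadic test functions on rings -/

theorem tendsto_sum_Ico_one_div (n₀ : ℕ) :
    Tendsto (fun N => ∑ k ∈ Finset.Ico n₀ N, 1 / (k : ℝ)) atTop atTop := by
  have h1 : Tendsto (fun N => ∑ k ∈ Finset.range N, 1 / (k : ℝ)) atTop atTop :=
    (not_summable_iff_tendsto_nat_atTop_of_nonneg fun k => by positivity).1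
      Real.not_summable_one_div_natCast
  have h2 := tendsto_atTop_add_const_right atTop
    (-∑ k ∈ Finset.range n₀, 1 / (k : ℝ)) h1
  refine h2.congr' ?_
  filter_upwards [eventually_ge_atTop n₀] with N hN
  rw [Finset.sum_Ico_eq_sub _ hN, sub_eq_add_neg]

/-- The growth of the sums that bound the energy of the test function. -/
theorem exists_sum_le {s q : ℝ} (hs : 0 ≤ s) (hq : 0 < q) (hsq : 2 ≤ s + q) :
    ∃ H : ℝ, 0 ≤ H ∧ ∃ β : ℝ, β < q ∧ ∀ n₀ N : ℕ, 1 ≤ n₀ →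
      ∑ k ∈ Finset.Ico n₀ N, ((1 / 2 : ℝ) ^ k) ^ s * (k : ℝ) ^ (s - 1) ≤
        H * (∑ k ∈ Finset.Ico n₀ N, 1 / (k : ℝ)) ^ β := by
  -- For `q > 1` each term is at most `1 / k`, so `β = 1` works. For `q ≤ 1` the hypothesis forces
  -- `s ≥ 1`, the series converges, and `β = 0` works.
  rcases lt_or_ge 1 q with h1q | hq1
  · refine ⟨1, zero_le_one, 1, h1q, fun n₀ N hn₀ => ?_⟩
    rw [Real.rpow_one, one_mul]
    refine Finset.sum_le_sum fun k hk => ?_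
    have hk1 : 1 ≤ k := hn₀.trans (Finset.mem_Ico.1 hk).1
    have hkpos : (0 : ℝ) < k := by exact_mod_cast hk1
    have hle : (1 / 2 : ℝ) ^ k * k ≤ 1 := by
      rw [one_div, inv_pow, inv_mul_le_iff₀ (by positivity), mul_one]
      exact_mod_cast Nat.lt_two_pow_self.le
    rw [Real.rpow_sub_one hkpos.ne', ← mul_div_assoc, ← Real.mul_rpow (by positivity) hkpos.le]
    gcongr
    exact Real.rpow_le_one (by positivity) hle hs
  · have hs1 : 1 ≤ s := by linarith
    set w : ℕ → ℝ := fun k => ((1 / 2 : ℝ) ^ k) ^ s * (k : ℝ) ^ (s - 1) with hw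
    have hw0 : ∀ k, 0 ≤ w k := fun k => by positivity
    have hsum : Summable fun k : ℕ => (k : ℝ) ^ ⌈s⌉₊ * ((1 / 2 : ℝ) ^ s) ^ k := by
      apply summable_pow_mul_geometric_of_norm_lt_one
      rw [Real.norm_of_nonneg (by positivity)]
      exact Real.rpow_lt_one (by norm_num) (by norm_num) (by linarith)
    have hws : Summable w := by
      rw [← summable_nat_add_iff 1]
      refine Summable.of_nonneg_of_le (fun k => hw0 _) (fun k => ?_)
        ((summable_nat_add_iff 1).2 hsum)
      have hk1 : (1 : ℝ) ≤ ((k + 1 : ℕ) : ℝ) := by exact_mod_cast Nat.le_add_left 1 k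
      have e1 : ((1 / 2 : ℝ) ^ (k + 1)) ^ s = ((1 / 2 : ℝ) ^ s) ^ (k + 1) := by
        rw [← Real.rpow_natCast, ← Real.rpow_natCast, ← Real.rpow_mul (by norm_num),
          ← Real.rpow_mul (by norm_num), mul_comm]
      simp only [hw]
      rw [e1, mul_comm]
      gcongr
      rw [← Real.rpow_natCast]
      refine Real.rpow_le_rpow_of_exponent_le hk1 ?_
      linarith [Nat.le_ceil s]
    refine ⟨∑' k, w k, tsum_nonneg hw0, 0, hq, fun n₀ N _ => ?_⟩
    rw [Real.rpow_zero, mul_one]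
    exact hws.sum_le_tsum _ fun k _ => hw0 k

/-- The dyadic test function with values `2 ^ (k + 1) / (k T)` on `[2 ^ (-k - 1), 2 ^ (-k))`. -/
noncomputable def dyadicWeight (n₀ N : ℕ) (T : ℝ) (t : ℝ) : ℝ≥0∞ :=
  ∑ k ∈ Finset.Ico n₀ N, (Ico ((1 / 2 : ℝ) ^ (k + 1)) ((1 / 2) ^ k)).indicator
    (fun _ => ENNReal.ofReal (2 ^ (k + 1) / (k * T))) t

theorem measurable_dyadicWeight (n₀ N : ℕ) (T : ℝ) : Measurable (dyadicWeight n₀ N T) :=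
  Finset.measurable_fun_sum _ fun _ _ => measurable_const.indicator measurableSet_Ico

/-- The dyadic intervals are disjoint, so at most one summand is nonzero at each `t`. -/
theorem dyadicWeight_rpow (n₀ N : ℕ) (T : ℝ) {q : ℝ} (hq : 0 < q) (t : ℝ) :
    dyadicWeight n₀ N T t ^ q =
      ∑ k ∈ Finset.Ico n₀ N, (Ico ((1 / 2 : ℝ) ^ (k + 1)) ((1 / 2) ^ k)).indicator
        (fun _ => ENNReal.ofReal (2 ^ (k + 1) / (k * T)) ^ q) t := by
  unfold dyadicWeight
  by_cases hex : ∃ j ∈ Finset.Ico n₀ N, t ∈ Ico ((1 / 2 : ℝ) ^ (j + 1)) ((1 / 2) ^ j)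
  · obtain ⟨j, hj, htj⟩ := hex
    have hdis : ∀ k, k ≠ j → t ∉ Ico ((1 / 2 : ℝ) ^ (k + 1)) ((1 / 2) ^ k) := by
      intro k hkj htk
      rcases lt_or_gt_of_ne hkj with h | h
      · have : (1 / 2 : ℝ) ^ j ≤ (1 / 2) ^ (k + 1) :=
          pow_le_pow_of_le_one (by norm_num) (by norm_num) h
        linarith [htj.2, htk.1]
      · have : (1 / 2 : ℝ) ^ k ≤ (1 / 2) ^ (j + 1) :=
          pow_le_pow_of_le_one (by norm_num) (by norm_num) h
        linarith [htk.2, htj.1]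
    rw [Finset.sum_eq_single j (fun k _ hk => indicator_of_notMem (hdis k hk) _)
      (fun h => absurd hj h), Finset.sum_eq_single j
      (fun k _ hk => indicator_of_notMem (hdis k hk) _) (fun h => absurd hj h),
      indicator_of_mem htj, indicator_of_mem htj]
  · push Not at hex
    rw [Finset.sum_eq_zero fun k hk => indicator_of_notMem (hex k hk) _,
      Finset.sum_eq_zero fun k hk => indicator_of_notMem (hex k hk) _, ENNReal.zero_rpow_of_pos hq]

/-- Each dyadic interval contributes `1 / (k * T)`, and `T` is the normalizing sum. -/
theorem one_le_lintegral_dyadicWeight {n₀ N : ℕ} (hn₀ : 1 ≤ n₀)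
    (hT : 0 < ∑ k ∈ Finset.Ico n₀ N, 1 / (k : ℝ)) :
    1 ≤ ∫⁻ t in Ioo ((1 / 2 : ℝ) ^ N) ((1 / 2) ^ n₀),
      dyadicWeight n₀ N (∑ k ∈ Finset.Ico n₀ N, 1 / (k : ℝ)) t := by
  set T := ∑ k ∈ Finset.Ico n₀ N, 1 / (k : ℝ) with hTdef
  unfold dyadicWeight
  rw [lintegral_finsetSum _ fun k _ => measurable_const.indicator measurableSet_Ico]
  have hterm : ∀ k ∈ Finset.Ico n₀ N, ENNReal.ofReal (1 / (k : ℝ) / T) ≤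
      ∫⁻ t in Ioo ((1 / 2 : ℝ) ^ N) ((1 / 2) ^ n₀),
        (Ico ((1 / 2 : ℝ) ^ (k + 1)) ((1 / 2) ^ k)).indicator
          (fun _ => ENNReal.ofReal (2 ^ (k + 1) / (k * T))) t := by
    intro k hk
    rw [Finset.mem_Ico] at hk
    have hkpos : (0 : ℝ) < k := by exact_mod_cast hn₀.trans hk.1
    rw [lintegral_indicator_const measurableSet_Ico, Measure.restrict_apply measurableSet_Ico]
    have hsub : Ioo ((1 / 2 : ℝ) ^ (k + 1)) ((1 / 2) ^ k) ⊆
        Ico ((1 / 2 : ℝ) ^ (k + 1)) ((1 / 2) ^ k) ∩ Ioo ((1 / 2 : ℝ) ^ N) ((1 / 2) ^ n₀) := by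
      have e1 : (1 / 2 : ℝ) ^ N ≤ (1 / 2) ^ (k + 1) :=
        pow_le_pow_of_le_one (by norm_num) (by norm_num) hk.2
      have e2 : (1 / 2 : ℝ) ^ k ≤ (1 / 2) ^ n₀ :=
        pow_le_pow_of_le_one (by norm_num) (by norm_num) hk.1
      intro t ht
      exact ⟨⟨ht.1.le, ht.2⟩, e1.trans_lt ht.1, ht.2.trans_le e2⟩
    calc ENNReal.ofReal (1 / (k : ℝ) / T)
        = ENNReal.ofReal (2 ^ (k + 1) / (k * T)) *
            volume (Ioo ((1 / 2 : ℝ) ^ (k + 1)) ((1 / 2) ^ k)) := by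
          rw [Real.volume_Ioo, ← ENNReal.ofReal_mul (by positivity)]
          congr 1
          rw [one_div_pow, one_div_pow, pow_succ]
          field_simp
          norm_num
      _ ≤ _ := by gcongr
  calc (1 : ℝ≥0∞) = ∑ k ∈ Finset.Ico n₀ N, ENNReal.ofReal (1 / (k : ℝ) / T) := by
        rw [← ENNReal.ofReal_sum_of_nonneg fun k _ => by positivity, ← Finset.sum_div, ← hTdef,
          div_self hT.ne', ENNReal.ofReal_one]
    _ ≤ _ := Finset.sum_le_sum hterm

variable [BorelSpace Z]

theorem lintegral_mul_dyadicWeight_le {ν : Measure Z} {Q : Z → ℝ≥0∞} (hQ : AEMeasurable Q ν)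
    (y₀ : Z) (n₀ N : ℕ) (T : ℝ) {q : ℝ} (hq : 0 < q) :
    ∫⁻ y, Q y * dyadicWeight n₀ N T (dist y y₀) ^ q ∂ν ≤
      ∑ k ∈ Finset.Ico n₀ N, ENNReal.ofReal (2 ^ (k + 1) / (k * T)) ^ q *
        ∫⁻ y in Metric.ball y₀ ((1 / 2) ^ k), Q y ∂ν := by
  simp only [dyadicWeight_rpow _ _ _ hq, Finset.mul_sum]
  rw [lintegral_finsetSum']
  · refine Finset.sum_le_sum fun k _ => ?_
    rw [← lintegral_const_mul'' _ hQ.restrict, ← lintegral_indicator Metric.isOpen_ball.measurableSet]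
    refine lintegral_mono fun y => ?_
    by_cases hy : dist y y₀ ∈ Ico ((1 / 2 : ℝ) ^ (k + 1)) ((1 / 2) ^ k)
    · rw [indicator_of_mem hy, indicator_of_mem (Metric.mem_ball.2 hy.2), mul_comm]
    · rw [indicator_of_notMem hy, mul_zero]
      exact zero_le
  · intro k _
    exact hQ.mul ((measurable_const.indicator measurableSet_Ico).comp
      (continuous_id.dist continuous_const).measurable).aemeasurable

/-- Under the growth condition on the weight there are rings around `y₀` and test functions on
them with arbitrarily small weighted energy. -/
theorem exists_ring_energy_le {ν : Measure Z} {a : ℝ} (ha : 2 ≤ a) {q : ℝ} (hq : 0 < q)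
    (hqa : q ≤ a) {y₀ : Z} {Q : Z → ℝ≥0∞} (hQ : AEMeasurable Q ν)
    (hgrowth : ∃ A : ℝ, 0 < A ∧ ∃ k₀ : ℕ, 1 ≤ k₀ ∧ ∀ k ≥ k₀,
      ∫⁻ y in Metric.ball y₀ ((1 / 2) ^ k), Q y ∂ν ≤
        ENNReal.ofReal (A * ((1 / 2 : ℝ) ^ k) ^ a * (k : ℝ) ^ (a - 1)))
    {r e : ℝ} (hr : 0 < r) (he : 0 < e) :
    ∃ r₁ r₂ : ℝ, 0 < r₁ ∧ r₁ < r₂ ∧ r₂ < r ∧ ∃ η : ℝ → ℝ≥0∞, Measurable η ∧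
      1 ≤ ∫⁻ t in Ioo r₁ r₂, η t ∧ ∫⁻ y, Q y * η (dist y y₀) ^ q ∂ν ≤ ENNReal.ofReal e := by
  obtain ⟨A, hA, k₀, hk₀, hgrowth⟩ := hgrowth
  obtain ⟨H, hH, β, hβ, hsum⟩ := exists_sum_le (s := a - q) (q := q) (by linarith) hq (by linarith)
  obtain ⟨n₀, hn₀k, hn₀r⟩ : ∃ n₀ ≥ k₀, (1 / 2 : ℝ) ^ n₀ < r := by
    have h1 := (tendsto_pow_atTop_nhds_zero_of_lt_one (r := (1 / 2 : ℝ)) (by norm_num)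
      (by norm_num)).eventually (gt_mem_nhds hr)
    obtain ⟨n, hn1, hn2⟩ := ((eventually_ge_atTop k₀).and h1).exists
    exact ⟨n, hn1, hn2⟩
  have hn₀ : 1 ≤ n₀ := hk₀.trans hn₀k
  have hT := tendsto_sum_Ico_one_div n₀
  set T : ℕ → ℝ := fun N => ∑ k ∈ Finset.Ico n₀ N, 1 / (k : ℝ) with hTdef
  -- The normalization gains `T ^ (-q)` while the energy sum grows only like `T ^ β` with `β < q`;
  -- divergence of the harmonic series makes the product vanish.
  have hlim : Tendsto (fun N => A * 2 ^ q * H * T N ^ (-(q - β))) atTop (𝓝 0) := by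
    have := ((tendsto_rpow_neg_atTop (sub_pos.2 hβ)).comp hT).const_mul (A * 2 ^ q * H)
    rwa [mul_zero] at this
  obtain ⟨N, hN1, hN2, hN3⟩ := ((hlim.eventually (gt_mem_nhds he)).and
    ((hT.eventually (eventually_gt_atTop 0)).and (eventually_gt_atTop n₀))).exists
  refine ⟨(1 / 2) ^ N, (1 / 2) ^ n₀, by positivity,
    pow_lt_pow_right_of_lt_one₀ (by norm_num) (by norm_num) hN3, hn₀r, dyadicWeight n₀ N (T N),
    measurable_dyadicWeight _ _ _, one_le_lintegral_dyadicWeight hn₀ hN2, ?_⟩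
  refine (lintegral_mul_dyadicWeight_le hQ y₀ n₀ N (T N) hq).trans ?_
  have hterm : ∀ k ∈ Finset.Ico n₀ N, ENNReal.ofReal (2 ^ (k + 1) / (k * T N)) ^ q *
      ∫⁻ y in Metric.ball y₀ ((1 / 2) ^ k), Q y ∂ν ≤
      ENNReal.ofReal (A * 2 ^ q * T N ^ (-q) *
        (((1 / 2 : ℝ) ^ k) ^ (a - q) * (k : ℝ) ^ (a - q - 1))) := by
    intro k hk
    rw [Finset.mem_Ico] at hk
    have hkpos : (0 : ℝ) < k := by exact_mod_cast hn₀.trans hk.1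
    have h1 := hgrowth k (hn₀k.le.trans hk.1)
    rw [ENNReal.ofReal_rpow_of_nonneg (by positivity) hq.le]
    refine (mul_le_mul_right h1 _).trans (le_of_eq ?_)
    rw [← ENNReal.ofReal_mul (by positivity)]
    congr 1
    set x : ℝ := (1 / 2) ^ k with hx
    have hxpos : 0 < x := by positivity
    have e1 : (2 : ℝ) ^ (k + 1) / (k * T N) = 2 / (x * k * T N) := by
      rw [hx, one_div_pow, pow_succ]; field_simp
    rw [e1, Real.div_rpow (by positivity) (by positivity), Real.mul_rpow (by positivity) hN2.le,
      Real.mul_rpow hxpos.le hkpos.le, Real.rpow_neg hN2.le, Real.rpow_sub hxpos,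
      show a - q - 1 = (a - 1) - q by ring, Real.rpow_sub hkpos (a - 1) q]
    field_simp
  refine (Finset.sum_le_sum hterm).trans ?_
  rw [← ENNReal.ofReal_sum_of_nonneg fun k _ => by positivity, ← Finset.mul_sum]
  apply ENNReal.ofReal_le_ofReal
  refine le_trans ?_ hN1.le
  calc A * 2 ^ q * T N ^ (-q) *
        ∑ k ∈ Finset.Ico n₀ N, ((1 / 2 : ℝ) ^ k) ^ (a - q) * (k : ℝ) ^ (a - q - 1)
      ≤ A * 2 ^ q * T N ^ (-q) * (H * T N ^ β) := by
        gcongr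
        exact hsum n₀ N hn₀
    _ = A * 2 ^ q * H * T N ^ (-(q - β)) := by
        rw [show -(q - β) = -q + β by ring, Real.rpow_add hN2]
        ring

end Growth

/-! ### Components of preimages -/

/-- If a continuous open map does not cover the connected open set `V ∋ g x₀` on a ball around
`x₀`, then some compact connected set reaches from `x₀` to the boundary of the ball and is mapped
into the closure of `V`. -/
theorem exists_mem_compactsCrossing {Y Z : Type*} [MetricSpace Y] [LocallyConnectedSpace Y]
    [TopologicalSpace Z] [T2Space Z] {g : Y → Z} (hg : Continuous g) (hgo : IsOpenMap g) {V : Set Z}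
    (hVo : IsOpen V) (hVc : IsPreconnected V) {x₀ : Y} (hx₀ : g x₀ ∈ V) {ε : ℝ} (hε : 0 < ε)
    (hK : IsCompact (Metric.closedBall x₀ ε)) (hV : ¬ V ⊆ g '' Metric.ball x₀ ε) :
    ∃ S ∈ compactsCrossing x₀ ε, MapsTo g S (closure V) := by
  set O := g ⁻¹' V ∩ Metric.ball x₀ ε with hO
  have hOo : IsOpen O := (hVo.preimage hg).inter Metric.isOpen_ball
  have hxO : x₀ ∈ O := ⟨hx₀, Metric.mem_ball_self hε⟩
  set U := connectedComponentIn O x₀ with hU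
  have hUo : IsOpen U := hOo.connectedComponentIn
  have hUO : U ⊆ O := connectedComponentIn_subset _ _
  have hxU : x₀ ∈ U := mem_connectedComponentIn hxO
  have hUc : IsPreconnected U := isPreconnected_connectedComponentIn
  have hcl : closure U ⊆ Metric.closedBall x₀ ε :=
    closure_minimal ((hUO.trans inter_subset_right).trans Metric.ball_subset_closedBall)
      Metric.isClosed_closedBall
  have hSc : IsCompact (closure U) := hK.of_isClosed_subset isClosed_closure hcl
  have hend : ∃ z ∈ closure U, dist z x₀ = ε := by
    by_contra! hcon
    have hlt : ∀ z ∈ closure U, dist z x₀ < ε := fun z hz => lt_of_le_of_ne (hcl hz) (hcon z hz)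
    refine hV (Subset.trans ?_ (image_mono (hUO.trans inter_subset_right)))
    -- If the closure of `U` stayed in the open ball, its points over `V` would lie in `U` by
    -- maximality of the component. Then `V` would be covered by two disjoint open sets, the image
    -- of `U` and the complement of the image of its closure, hence by the first.
    refine hVc.subset_left_of_subset_union (hgo U hUo) (hSc.image hg).isClosed.isOpen_compl ?_ ?_
      ⟨g x₀, hx₀, mem_image_of_mem g hxU⟩
    · exact disjoint_compl_right_iff_subset.2 (image_mono subset_closure)
    · intro v hv
      by_cases hvK : v ∈ g '' closure U
      · obtain ⟨z, hz, rfl⟩ := hvK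
        refine Or.inl (mem_image_of_mem g ?_)
        have hins : IsPreconnected (insert z U) :=
          hUc.subset_closure (subset_insert _ _) (insert_subset hz subset_closure)
        exact hins.subset_connectedComponentIn (mem_insert_of_mem _ hxU)
          (insert_subset (show z ∈ O from ⟨hv, hlt z hz⟩) hUO) (mem_insert _ _)
      · exact Or.inr hvK
  obtain ⟨z, hz, hzε⟩ := hend
  refine ⟨closure U, ⟨hSc, fun t ht => ?_⟩, ?_⟩
  · have := hUc.closure.intermediate_value (subset_closure hxU) hz
      (f := fun w => dist w x₀) (continuous_id.dist continuous_const).continuousOn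
    rw [dist_self, hzε] at this
    exact this ht
  · have hm : MapsTo g U V := fun w hw => (hUO hw).1
    exact hm.closure hg

/-- A continuous function that passes from values `≤ r₁` to values `≥ r₂` does so on a subsegment
on which it stays strictly between `r₁` and `r₂`. -/
theorem exists_crossing_segment {d : ℝ → ℝ} (hd : Continuous d) {ℓ r₁ r₂ : ℝ} (hℓ : 0 ≤ ℓ)
    (hr : r₁ < r₂) (h0 : d 0 ≤ r₁) (h1 : r₂ ≤ d ℓ) :
    ∃ s t, 0 ≤ s ∧ s ≤ t ∧ t ≤ ℓ ∧ d s = r₁ ∧ d t = r₂ ∧ ∀ w ∈ Ioo s t, r₁ < d w ∧ d w < r₂ := by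
  -- The segment runs from the last time at level at most `r₁` to the first later time at level at
  -- least `r₂`.
  obtain ⟨s, ⟨hs, hds⟩, hsmax⟩ := (isCompact_Icc.inter_right
    (isClosed_le hd continuous_const) : IsCompact (Icc 0 ℓ ∩ {w | d w ≤ r₁})).exists_isGreatest
    ⟨0, ⟨le_rfl, hℓ⟩, h0⟩
  have hds' : d s = r₁ := by
    obtain ⟨w, hw, hdw⟩ := intermediate_value_Icc hs.2 hd.continuousOn ⟨hds, hr.le.trans h1⟩
    have : w ≤ s := hsmax ⟨⟨hs.1.trans hw.1, hw.2⟩, hdw.le⟩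
    rw [← hdw, le_antisymm this hw.1]
  obtain ⟨t, ⟨ht, hdt⟩, htmin⟩ := (isCompact_Icc.inter_right
    (isClosed_le continuous_const hd) : IsCompact (Icc s ℓ ∩ {w | r₂ ≤ d w})).exists_isLeast
    ⟨ℓ, ⟨hs.2, le_rfl⟩, h1⟩
  have hdt' : d t = r₂ := by
    obtain ⟨w, hw, hdw⟩ := intermediate_value_Icc ht.1 hd.continuousOn
      ⟨hds'.le.trans hr.le, hdt⟩
    have : t ≤ w := htmin ⟨⟨hw.1, hw.2.trans ht.2⟩, hdw.ge⟩
    rw [← hdw, le_antisymm this hw.2]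
  refine ⟨s, t, hs.1, ht.1, ht.2, hds', hdt', fun w hw => ⟨?_, ?_⟩⟩
  · by_contra hcon
    exact absurd (hsmax ⟨⟨hs.1.trans hw.1.le, hw.2.le.trans ht.2⟩, not_lt.1 hcon⟩) (not_le.2 hw.1)
  · by_contra hcon
    exact absurd (htmin ⟨⟨hw.1.le, hw.2.le.trans ht.2⟩, not_lt.1 hcon⟩) (not_le.2 hw.2)

/-- For an equicontinuous family on a compact set `E` whose images of `E` have diameter at least
`δ`, finitely many balls suffice: every member maps one of them away from any given point. -/
theorem exists_finite_far_balls {X Z : Type*} [MetricSpace X] [MetricSpace Z] {E : Set X}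
    (hE : IsCompact E) {H : Set (X → Z)} (hequi : ∀ x ∈ E, H.EquicontinuousAt x) {δ : ℝ}
    (hδ : 0 < δ) (hdiam : ∀ f ∈ H, δ ≤ Metric.diam (f '' E)) :
    ∃ (T : Finset X) (r : X → ℝ), (∀ e ∈ T, e ∈ E ∧ 0 < r e) ∧ ∀ f ∈ H, ∀ y₀ : Z, ∃ e ∈ T,
      ∀ x ∈ Metric.closedBall e (r e), δ / 16 < dist (f x) y₀ := by
  have hr : ∀ e ∈ E, ∃ r > 0, ∀ f ∈ H, ∀ x ∈ Metric.closedBall e r,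
      dist (f e) (f x) < δ / 16 := by
    intro e he
    obtain ⟨r, hr, hrf⟩ := Metric.equicontinuousAt_iff.1 (hequi e he) (δ / 16) (by positivity)
    refine ⟨r / 2, by positivity, fun f hf x hx => hrf x ?_ ⟨f, hf⟩⟩
    rw [Metric.mem_closedBall] at hx
    linarith
  choose! r hr0 hrf using hr
  obtain ⟨T, hTE, hT⟩ := hE.elim_nhds_subcover (fun e => Metric.closedBall e (r e))
    fun e he => Metric.closedBall_mem_nhds e (hr0 e he)
  refine ⟨T, r, fun e he => ⟨hTE e he, hr0 e (hTE e he)⟩, fun f hf y₀ => ?_⟩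
  -- Otherwise the image of `E` would have diameter at most `δ / 2`. Passing from `a` to any point
  -- of its covering ball costs two errors of `δ / 16`.
  obtain ⟨a, ha, hfa⟩ : ∃ a ∈ E, δ / 4 < dist (f a) y₀ := by
    by_contra! hcon
    have : Metric.diam (f '' E) ≤ δ / 2 := by
      refine Metric.diam_le_of_forall_dist_le (by positivity) ?_
      rintro _ ⟨x, hx, rfl⟩ _ ⟨z, hz, rfl⟩
      linarith [dist_triangle_right (f x) (f z) y₀, hcon x hx, hcon z hz]
    linarith [hdiam f hf]
  obtain ⟨e, he, hae⟩ := mem_iUnion₂.1 (hT ha)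
  refine ⟨e, he, fun x hx => ?_⟩
  have h1 := hrf e (hTE e he) f hf x hx
  have h2 := hrf e (hTE e he) f hf a hae
  have h3 := dist_triangle4 (f a) (f e) (f x) y₀
  rw [dist_comm (f a) (f e)] at h3
  linarith

/-! ### The covering theorem near one point of the target -/

/-- Lower bound for the modulus: if `S ⊆ D` crosses the spheres around `x₀`, lies over the closed
ball `B(y₀, r₁)`, and the ball `B(e, s)` lies over the complement of `B(y₀, r₂)`, then the modulus of
`Γ_f(y₀, r₁, r₂)` is at least `c`, provided that functions of energy at most `c` have short paths
from `S` to the ball. -/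
theorem le_modulus_preimagePaths {X Z : Type*} [MetricSpace X] [MeasurableSpace X] [BorelSpace X]
    [MetricSpace Z] {μ : Measure X} {p : ℝ} {D : Set X} (hD : IsOpen D) {f : X → Z}
    (hf : ContinuousOn f D) {y₀ : Z} {r₁ r₂ : ℝ} (hr : r₁ < r₂) {S : Set D} {e : D} {s c : ℝ}
    (hS : ∀ x ∈ S, dist (f x) y₀ ≤ r₁) (he : ∀ x ∈ Metric.closedBall e s, r₂ ≤ dist (f x) y₀)
    (hpath : ∀ ρ : D → ℝ≥0∞, Measurable ρ →
      ∫⁻ y, ρ y ^ p ∂(μ.comap ((↑) : D → X)) ≤ ENNReal.ofReal c →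
      ∃ (ℓ : ℝ) (φ : ℝ → D), 0 ≤ ℓ ∧ LipschitzWith 1 φ ∧ φ 0 ∈ S ∧ φ ℓ ∈ Metric.closedBall e s ∧
        ∫⁻ t in Icc 0 ℓ, ρ (φ t) < 1) :
    ENNReal.ofReal c ≤ modulus μ p (preimagePaths D f y₀ r₁ r₂) := by
  refine le_iInf₂ fun ρ hρ => ?_
  by_contra! hlt
  obtain ⟨hρm, hρadm⟩ := hρ
  obtain ⟨ℓ, φ, hℓ, hlip, h0, hend, hint⟩ := hpath (fun x => ρ x)
    (hρm.comp measurable_subtype_coe) (by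
      rw [lintegral_subtype_comap hD.measurableSet fun x => ρ x ^ p]
      exact (setLIntegral_le_lintegral _ _).trans hlt.le)
  have hdc : Continuous fun t => dist (f (φ t)) y₀ :=
    ((hf.comp_continuous (continuous_subtype_val.comp hlip.continuous)
      fun t => (φ t).2).dist continuous_const)
  -- Cutting the path down to one crossing of the ring puts it in the family and can only decrease
  -- the integral of `ρ`.
  obtain ⟨a, b, ha, hab, hb, hfa, hfb, hw⟩ :=
    exists_crossing_segment hdc hℓ hr (hS _ h0) (he _ hend)
  have hψ : LipschitzOnWith 1 (fun t => (φ t : X)) (Icc a b) := fun x _ y _ => hlip x y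
  have h1 := hρadm (Curve.ofLipschitz hab hψ)
    ⟨fun t _ => (φ t).2, hfa, hfb, hw⟩ (Curve.ofLipschitz_rectifiable hab hψ)
  have h2 := h1.trans (Curve.lineIntegral_ofLipschitz_le hab hψ hρm)
  have h3 : ∫⁻ t in Icc a b, ρ (φ t) ≤ ∫⁻ t in Icc 0 ℓ, ρ (φ t) :=
    lintegral_mono_set (Icc_subset_Icc ha hb)
  exact absurd (h2.trans h3) (not_le.2 hint)

end KoebeMetric

/-! ### The main theorem -/

theorem theorem1p2 {X X' : Type*}
    [MetricSpace X] [MeasurableSpace X] [BorelSpace X]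
    [MetricSpace X'] [MeasurableSpace X'] [BorelSpace X']
    (μ : Measure X) (hμ : ∀ (x : X) (r : ℝ), 0 < r →
      0 < μ (Metric.ball x r) ∧ μ (Metric.ball x r) < ∞)
    (μ' : Measure X') [IsLocallyFiniteMeasure μ']
    (α α' p q : ℝ) (hα : 2 ≤ α) (hα' : 2 ≤ α')
    (hp : α - 1 < p) (hpα : p ≤ α) (hq : 0 < q) (hqα' : q ≤ α')
    -- the domain `D` in `X`, regarded as a metric measure space with the induced structure
    (D : Set X) (hDopen : IsOpen D) (hDconn : IsConnected D)
    [LocallyConnectedSpace D] [LocallyCompactSpace D]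
    (hDreg : KoebeMetric.AhlforsRegular (μ.comap ((↑) : D → X)) α)
    (hDpoin : KoebeMetric.SupportsPoincare (μ.comap ((↑) : D → X)) p)
    -- the domain `D'` in `X'`
    (D' : Set X') (hD'open : IsOpen D') (hD'conn : IsConnected D')
    (hD'comp : IsCompact (closure D'))
    -- the target space `X'`
    [LocallyPathConnectedSpace X'] [LocallyCompactSpace X']
    (hX'reg : KoebeMetric.UpperRegular μ' α')
    (hX'doubling : ∀ z₀ : X', ∃ γ : ℝ, 0 < γ ∧ ∃ r₀ : ℝ, 0 < r₀ ∧ ∀ r : ℝ, 0 < r → r < r₀ →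
      μ' (Metric.ball z₀ (2 * r)) ≤
        ENNReal.ofReal (γ * Real.log (1 / r) ^ (α' - 2)) * μ' (Metric.ball z₀ r))
    -- the weight `Q`
    (Q : X' → ℝ≥0∞) (hQ : AEMeasurable Q μ')
    (hQfmo : ∀ y₀ ∈ closure D', KoebeMetric.FMOAt μ' Q y₀)
    -- the continuum `E` and the number `δ`
    (E : Set X) (hED : E ⊆ D) (hEcomp : IsCompact E) (hEconn : IsConnected E)
    (δ : ℝ) (hδ : 0 < δ)
    (hequi : ∀ x₁ ∈ E,
      (KoebeMetric.mappingClass μ μ' p q Q E δ D D').EquicontinuousAt x₁)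
    (x₀ : X) (ε₁ : ℝ) (hε₁ : 0 < ε₁) (hball : Metric.ball x₀ ε₁ ⊆ D) :
    ∃ r₀ : ℝ, 0 < r₀ ∧ ∀ f ∈ KoebeMetric.mappingClass μ μ' p q Q E δ D D',
      Metric.ball (f x₀) r₀ ⊆ f '' Metric.ball x₀ ε₁ := by
  set H := KoebeMetric.mappingClass μ μ' p q Q E δ D D' with hH
  rcases H.eq_empty_or_nonempty with hemp | ⟨f₀, hf₀⟩
  · exact ⟨1, one_pos, fun f hf => absurd hf (hemp ▸ notMem_empty f)⟩
  -- A one-point domain is excluded by `δ > 0` as soon as the class has a member.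
  have hnt : Nontrivial D := by
    by_contra hcon
    have hsub : D.Subsingleton :=
      not_nontrivial_iff.1 fun h => hcon (nontrivial_coe_sort.2 h)
    have h0 : Metric.diam (f₀ '' E) = 0 := Metric.diam_subsingleton ((hsub.anti hED).image f₀)
    have h1 : δ ≤ Metric.diam (f₀ '' E) := hf₀.2.2
    linarith
  have hp1 : 1 ≤ p := by linarith
  set ν := μ.comap ((↑) : D → X) with hν
  have hνfin : ∀ (x : D) r, ν (Metric.ball x r) < ∞ := by
    intro x r
    rcases le_or_gt r 0 with hr | hr
    · rw [Metric.ball_eq_empty.2 hr, measure_empty]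
      exact ENNReal.zero_lt_top
    · rw [hν, (MeasurableEmbedding.subtype_coe hDopen.measurableSet).comap_apply]
      refine lt_of_le_of_lt (measure_mono ?_) (hμ x r hr).2
      rintro _ ⟨z, hz, rfl⟩
      exact hz
  obtain ⟨c, C, K, τ, r₁, hdata⟩ := KoebeMetric.exists_poincareData hp1 hνfin hDreg hDpoin
  have hconnY : PreconnectedSpace D := isPreconnected_iff_preconnectedSpace.1 hDconn.isPreconnected
  have hx₀D : x₀ ∈ D := hball (Metric.mem_ball_self hε₁)
  set a₀ : D := ⟨x₀, hx₀D⟩ with ha₀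
  obtain ⟨R, hR, hRc⟩ := KoebeMetric.exists_isCompact_closedBall_radius a₀
  set ε := min R (ε₁ / 2) with hε
  have hεpos : 0 < ε := by positivity
  have hεc : IsCompact (Metric.closedBall a₀ ε) :=
    hRc.of_isClosed_subset Metric.isClosed_closedBall
      (Metric.closedBall_subset_closedBall (min_le_left _ _))
  obtain ⟨T, s, hTs, hTfar⟩ := KoebeMetric.exists_finite_far_balls hEcomp hequi hδ
    fun f hf => hf.2.2
  -- a lower bound for the moduli
  obtain ⟨κ, hκ, hκT⟩ : ∃ κ : ℝ, 0 < κ ∧ ∀ e ∈ T, ∀ he : e ∈ D, ∀ ρ : D → ℝ≥0∞, Measurable ρ →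
      ∫⁻ y, ρ y ^ p ∂ν ≤ ENNReal.ofReal κ → ∀ S ∈ KoebeMetric.compactsCrossing a₀ ε,
        ∃ (ℓ : ℝ) (φ : ℝ → D), 0 ≤ ℓ ∧ LipschitzWith 1 φ ∧ φ 0 ∈ S ∧
          φ ℓ ∈ Metric.closedBall ⟨e, he⟩ (s e) ∧ ∫⁻ t in Icc 0 ℓ, ρ (φ t) < 1 := by
    have hev : ∀ᶠ κ in 𝓝[>] (0 : ℝ), ∀ e ∈ T, ∀ he : e ∈ D, ∀ ρ : D → ℝ≥0∞, Measurable ρ →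
        ∫⁻ y, ρ y ^ p ∂ν ≤ ENNReal.ofReal κ → ∀ S ∈ KoebeMetric.compactsCrossing a₀ ε,
          ∃ (ℓ : ℝ) (φ : ℝ → D), 0 ≤ ℓ ∧ LipschitzWith 1 φ ∧ φ 0 ∈ S ∧
            φ ℓ ∈ Metric.closedBall ⟨e, he⟩ (s e) ∧ ∫⁻ t in Icc 0 ℓ, ρ (φ t) < 1 := by
      rw [eventually_all_finset]
      intro e he
      obtain ⟨κ, hκ, hκe⟩ := hdata.exists_path_to_closedBall hp1 hp a₀ hεpos
        ⟨e, hED (hTs e he).1⟩ (hTs e he).2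
      filter_upwards [Ioc_mem_nhdsGT hκ] with κ' hκ' _ ρ hρ hρκ
      exact hκe ρ hρ (hρκ.trans (ENNReal.ofReal_le_ofReal hκ'.2))
    obtain ⟨κ, hκ, hκ'⟩ := (hev.and self_mem_nhdsWithin).exists
    exact ⟨κ, hκ', hκ⟩
  -- each point of the compact set `closure D'` has a suitable neighbourhood
  have hlocal : ∀ y : closure D', ∃ V : Set X', IsOpen V ∧ (y : X') ∈ V ∧
      ∀ f ∈ H, f x₀ ∈ V → V ⊆ f '' Metric.ball x₀ ε₁ := by
    rintro ⟨y, hy⟩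
    -- Outer radius below `δ / 16` puts the far ball over the outside of the ring; energy at most `κ
    -- / 2` contradicts the lower bound `κ`.
    obtain ⟨r₁, r₂, hr₁, hr₁₂, hr₂, η, hηm, hη1, hηe⟩ := KoebeMetric.exists_ring_energy_le hα' hq
      hqα' hQ ((hQfmo y hy).exists_lintegral_ball_le hα' hQ hX'reg (hX'doubling y))
      (by positivity : 0 < δ / 16) (by positivity : 0 < κ / 2)
    obtain ⟨V, hVsub, hVo, hyV, hVc⟩ := locallyConnectedSpace_iff_subsets_isOpen_isConnected.1
      inferInstance y (Metric.ball y r₁) (Metric.ball_mem_nhds y hr₁)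
    refine ⟨V, hVo, hyV, fun f hf hfV => ?_⟩
    by_contra hcon
    obtain ⟨hod, hpol, -⟩ := id hf
    have hgc : Continuous fun x : D => f x := continuousOn_iff_continuous_domRestrict.1 hod.continuousOn
    have hgo : IsOpenMap fun x : D => f x := by
      intro U hU
      have := hod.isOpen_image ((↑) '' U) (by rintro _ ⟨x, -, rfl⟩; exact x.2)
        (hDopen.isOpenMap_subtype_val U hU)
      rwa [image_image] at this
    obtain ⟨S, hS, hSV⟩ := KoebeMetric.exists_mem_compactsCrossing hgc hgo hVo hVc.isPreconnected
      (x₀ := a₀) hfV hεpos hεc fun h => hcon (h.trans (by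
        rintro _ ⟨x, hx, rfl⟩
        refine mem_image_of_mem f ?_
        have h1 : dist (x : X) x₀ < ε := hx
        rw [Metric.mem_ball]
        linarith [min_le_right R (ε₁ / 2)]))
    obtain ⟨e, heT, hefar⟩ := hTfar f hf y
    have heD : e ∈ D := hED (hTs e heT).1
    have hlow : ENNReal.ofReal κ ≤
        KoebeMetric.modulus μ p (KoebeMetric.preimagePaths D f y r₁ r₂) := by
      refine KoebeMetric.le_modulus_preimagePaths hDopen hod.continuousOn hr₁₂ (S := S)
        (e := ⟨e, heD⟩) (s := s e) (fun x hx => ?_) (fun x hx => ?_)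
        fun ρ hρ hρκ => hκT e heT heD ρ hρ hρκ S hS
      · exact closure_minimal (hVsub.trans Metric.ball_subset_closedBall)
          Metric.isClosed_closedBall (hSV hx)
      · exact (hr₂.trans (hefar x hx)).le
    have hup := hpol y r₁ r₂ hr₁ hr₁₂
      ⟨e, heD, hr₂.trans (hefar e (Metric.mem_closedBall_self (hTs e heT).2.le))⟩ η
      hηm.aemeasurable hη1
    have hfinal := hlow.trans (hup.trans ((setLIntegral_le_lintegral _ _).trans hηe))
    rw [ENNReal.ofReal_le_ofReal_iff (by positivity)] at hfinal
    linarith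
  choose V hVo hVy hVf using hlocal
  -- The neighbourhoods do not depend on `f`, hence neither does their Lebesgue number.
  obtain ⟨r₀, hr₀, hleb⟩ := lebesgue_number_lemma_of_metric hD'comp hVo
    fun y hy => mem_iUnion.2 ⟨⟨y, hy⟩, hVy ⟨y, hy⟩⟩
  refine ⟨r₀, hr₀, fun f hf => ?_⟩
  obtain ⟨y, hy⟩ := hleb (f x₀) (subset_closure (hf.1.mapsTo hx₀D))
  exact hy.trans (hVf y f hf (hy (Metric.mem_ball_self hr₀)))
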